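/- **Theorem 6.10.** An NFA $A=(Q,\Sigma,\cdot,I,F)$ (with $Q$ finite and nonempty, $I,F\subseteq Q$ and $\cdot : Q\times\Sigma\to 2^Q$) accepts the language $L(A)=\{w\in\Sigma^*\mid (I\cdot w)\cap F\neq\emptyset\}$. It is *complete* if $q\cdot a\ne\emptyset$ for all $q\in Q$ and $a\in\Sigma$, and *partially ordered* if the reachability relation on $Q$ is a partial order. It has the *unique maximal state property* if every state $p$ is the unique maximal state of the connected component containing $p$ of the graph on $Q$ whose edges are the transitions of $A$ under the letters of $\Sigma(p)=\{a\in\Sigma\mid p\in p\cdot a\}$; here components are those of the underlying undirected graph, and a state is maximal if no other state is reachable from it in the directed graph. A *ptNFA* is a complete, partially ordered NFA with the unique maximal state property. The *depth* of $A$ is the number of transitions on a longest simple path starting in an initial state ($0$ if there is no initial state). A language over $\Sigma$ is *$k$-piecewise testable* if it is a finite Boolean combination of languages $\Sigma^*a_1\Sigma^*\cdots\Sigma^*a_n\Sigma^*$ with $a_i\in\Sigma$ and $0\le n\le k$. Let the alphabet be unary, $\Sigma=\{a\}$. Then the $k$-piecewise testability problem for ptNFAs is decidable in polynomial time even if $k$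 is part of the input: there is a Turing machine which, given an NFA $A$ over $\{a\}$ (by its initial states, its accepting states and its transition matrix) and a number $k\ge 0$ in binary, decides in time polynomial in the length of the input whether $A$ is a ptNFA and $L(A)$ is $k$-piecewise testable. Moreover, for every ptNFA $A$ over $\{a\}$ and every $k\ge 0$, the language $L(A)$ is $k$-piecewise testable if and only if, for all $j$ with $k<j\le \operatorname{depth}(A)$, the word $a^j$ is accepted by $A$ exactly when $a^k$ is. -/

import Mathlib

/-! ### Piecewise testable languages -/

/-- The language `Σ* a₁ Σ* a₂ Σ* ⋯ Σ* aₙ Σ*` of the words into which `u = a₁ a₂ ⋯ aₙ` embeds. -/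
def pieceLanguage {α : Type*} : List α → Language α
  | [] => ⊤
  | a :: u => ⊤ * {[a]} * pieceLanguage u

/-- A language is `k`-piecewise testable if it is a finite boolean combination of languages
`Σ* a₁ Σ* ⋯ Σ* aₙ Σ*` with `n ≤ k`. -/
def IsKPiecewiseTestable {α : Type*} (k : ℕ) (L : Language α) : Prop :=
  L ∈ BooleanSubalgebra.closure {P : Language α | ∃ u : List α, u.length ≤ k ∧ P = pieceLanguage u}

/-! ### ptNFAs -/

/-- The edge relation of the directed graph `G(A, Γ)` on the states of `A`. -/
def NFA.GraphEdge {α σ : Type*} (A : NFA α σ) (Γ : Set α) (p q : σ) : Prop :=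
  ∃ a ∈ Γ, q ∈ A.step p a

/-- The reachability relation `p ≤ q` on states: some word leads from `p` to `q`. -/
def NFA.Reaches {α σ : Type*} (A : NFA α σ) (p q : σ) : Prop :=
  ∃ w : List α, q ∈ A.evalFrom {p} w

/-- In every state, there is a transition under every letter. -/
def NFA.IsComplete {α σ : Type*} (A : NFA α σ) : Prop :=
  ∀ p a, (A.step p a).Nonempty

/-- The reachability relation is a partial order. -/
def NFA.IsPartiallyOrdered {α σ : Type*} (A : NFA α σ) : Prop :=
  IsPartialOrder σ A.Reaches

/-- The set `Σ(p)` of the letters under which there is a self-loop in the state `p`. -/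
def NFA.loopLetters {α σ : Type*} (A : NFA α σ) (p : σ) : Set α :=
  {a | p ∈ A.step p a}

/-- The state `q` is maximal in `G(A, Γ)`: no other state is reachable from it in that graph. -/
def NFA.IsMaximalIn {α σ : Type*} (A : NFA α σ) (Γ : Set α) (q : σ) : Prop :=
  ∀ r, Relation.ReflTransGen (A.GraphEdge Γ) q r → r = q

/-- The unique maximal state property: every state `p` is the unique maximal state of the
connected component of `G(A, Σ(p))` containing `p` (edges are taken without orientation in
the notion of a connected component). -/
def NFA.HasUMS {α σ : Type*} (A : NFA α σ) : Prop :=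
  ∀ p q, Relation.EqvGen (A.GraphEdge (A.loopLetters p)) p q →
    (A.IsMaximalIn (A.loopLetters p) q ↔ q = p)

/-- A ptNFA is a partially ordered complete NFA with the unique maximal state property. -/
def NFA.IsPtNFA {α σ : Type*} (A : NFA α σ) : Prop :=
  A.IsPartiallyOrdered ∧ A.IsComplete ∧ A.HasUMS

/-- The number of transitions of a longest simple path that starts in an initial state. A simple
path is given by the list of its states. -/
noncomputable def NFA.depth {α σ : Type*} (A : NFA α σ) : ℕ :=
  sSup {m | ∃ l : List σ, l.Nodup ∧ l.IsChain (A.GraphEdge Set.univ) ∧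
    (∃ q ∈ A.start, l.head? = some q) ∧ l.length = m + 1}

/-! ### The decision problem -/

/-- An NFA over a one-letter alphabet with a finite nonempty set of states, namely `Fin (n + 1)`
for some `n`. -/
abbrev UnaryNFA : Type := Σ n : ℕ, NFA Unit (Fin (n + 1))

open Classical in
/-- The row of a state: is it initial, is it accepting, and its row of the transition matrix,
closed by the separator `none`. -/
noncomputable def encodeState {n : ℕ} (A : NFA Unit (Fin (n + 1))) (p : Fin (n + 1)) :
    List (Option Bool) :=
  some (decide (p ∈ A.start)) :: some (decide (p ∈ A.accept)) ::
    ((List.finRange (n + 1)).map fun q => some (decide (q ∈ A.step p ()))) ++ [none]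

/-- The encoding of a pair of a unary NFA and a number: the number in binary, a separator, and
the rows of all states. -/
noncomputable def encodeInstance (x : UnaryNFA × ℕ) : List (Option Bool) :=
  (Computability.encodeNat x.2).map some ++
    none :: (List.finRange (x.1.1 + 1)).flatMap (encodeState x.1.2)

/-- The set `S` is decidable in polynomial time, under the given encoding of its ambient type by
words over a finite alphabet: a Turing machine computes its characteristic function in a time
polynomial in the length of the encoding. -/
def DecidableInPolyTime {X Γ : Type} (encode : X → List Γ) (S : Set X) : Prop :=
  ∃ f : X → Bool, (∀ x, f x = true ↔ x ∈ S) ∧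
    Nonempty (Turing.TM2ComputableInPolyTime encode Computability.encodeBool f)

/-!
Over one letter, the subwords of `a ^ j` of length at most `k` determine exactly `min j k`, so a
language is `k`-piecewise testable iff the acceptance of `a ^ j` is constant for `j ≥ k`. In a ptNFA
a walk moves strictly upwards until it reaches a state with a self-loop. By the unique maximal state
property it never leaves that state, which depends only on the state in which the walk started.
Hence acceptance is constant from the depth on.

Conversely, an NFA with at most `m` states is a ptNFA iff, for each state `p`, all walks of lengths
`m` and `m + 1` from `p` end in one and the same state. Both this condition and the constancy of
acceptance are tested by polynomially many products of a Boolean vector with the transition matrix,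
and `k` matters only up to the number of states. The tests are written in a small language whose
loops are all repeated as often as the input is long; compiling it to a Turing machine with a clock
for each loop gives the polynomial time bound.
-/

/-! ### Piecewise testability -/

theorem mem_booleanSubalgebra_closure_iff_of_finite {α : Type*} {𝒢 : Set (Set α)}
    (h𝒢 : 𝒢.Finite) {S : Set α} :
    S ∈ BooleanSubalgebra.closure 𝒢 ↔
      ∀ x y, (∀ G ∈ 𝒢, x ∈ G ↔ y ∈ G) → (x ∈ S ↔ y ∈ S) := by
  constructor
  · intro hS x y hxy
    induction hS using BooleanSubalgebra.closure_bot_sup_induction with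
    | mem G hG => exact hxy G hG
    | bot => exact Iff.rfl
    | sup S _ T _ hS hT => exact or_congr hS hT
    | compl S _ hS => exact not_congr hS
  · intro hS
    let atom (𝒟 : Set (Set α)) : Set α := (⨅ G ∈ 𝒟, G) ⊓ (⨆ G ∈ 𝒢 \ 𝒟, G)ᶜ
    have atom_mem : ∀ 𝒟 ⊆ 𝒢, atom 𝒟 ∈ BooleanSubalgebra.closure 𝒢 := fun 𝒟 h𝒟 =>
      BooleanSubalgebra.inf_mem
        (BooleanSubalgebra.biInf_mem (h𝒢.subset h𝒟)
          fun G hG => BooleanSubalgebra.subset_closure (h𝒟 hG))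
        (BooleanSubalgebra.compl_mem <| BooleanSubalgebra.biSup_mem h𝒢.sdiff
          fun G hG => BooleanSubalgebra.subset_closure hG.1)
    have mem_atom (x y : α) : y ∈ atom {G ∈ 𝒢 | x ∈ G} ↔ ∀ G ∈ 𝒢, x ∈ G ↔ y ∈ G := by
      simp only [atom, Set.iInf_eq_iInter, Set.iSup_eq_iUnion, Set.inf_eq_inter, Set.mem_inter_iff,
        Set.mem_compl_iff, Set.mem_iInter₂, Set.mem_iUnion₂, Set.mem_sep_iff, Set.mem_sdiff]
      grind
    have hS_eq : S = sSup (atom '' {𝒟 | 𝒟 ⊆ 𝒢 ∧ atom 𝒟 ⊆ S}) := by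
      refine Set.Subset.antisymm (fun x hx => ?_) (Set.sUnion_subset ?_)
      · refine Set.mem_sUnion.2 ⟨_, ⟨{G ∈ 𝒢 | x ∈ G}, ⟨Set.sep_subset _ _, fun y hy => ?_⟩, rfl⟩,
          (mem_atom x x).2 fun _ _ => Iff.rfl⟩
        exact (hS x y ((mem_atom x y).1 hy)).1 hx
      · rintro _ ⟨𝒟, h𝒟, rfl⟩
        exact h𝒟.2
    rw [hS_eq]
    refine BooleanSubalgebra.sSup_mem ((h𝒢.finite_subsets.subset fun 𝒟 h𝒟 => h𝒟.1).image atom) ?_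
    rintro _ ⟨𝒟, h𝒟, rfl⟩
    exact atom_mem 𝒟 h𝒟.1

theorem mem_pieceLanguage_iff_sublist {α : Type*} {u w : List α} :
    w ∈ pieceLanguage u ↔ u.Sublist w := by
  induction u generalizing w with
  | nil => exact iff_of_true (Set.mem_univ w) w.nil_sublist
  | cons a u ih =>
    simp only [pieceLanguage, Language.mem_mul, List.cons_sublist_iff]
    constructor
    · rintro ⟨_, ⟨x, _, _, rfl, rfl⟩, z, hz, rfl⟩
      exact ⟨x ++ [a], z, rfl, by simp, ih.1 hz⟩
    · rintro ⟨r₁, r₂, rfl, ha, hu⟩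
      obtain ⟨x, y, rfl⟩ := List.append_of_mem ha
      exact ⟨x ++ [a], ⟨x, Set.mem_univ x, [a], rfl, rfl⟩, y ++ r₂,
        ih.2 (hu.trans (List.sublist_append_right y r₂)), by simp⟩

theorem isKPiecewiseTestable_iff_sublist {α : Type*} [Finite α] {k : ℕ} {L : Language α} :
    IsKPiecewiseTestable k L ↔ ∀ v w : List α,
      (∀ u : List α, u.length ≤ k → (u.Sublist v ↔ u.Sublist w)) → (v ∈ L ↔ w ∈ L) := by
  have hfinite : {P : Language α | ∃ u : List α, u.length ≤ k ∧ P = pieceLanguage u}.Finite :=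
    ((List.finite_length_le α k).image pieceLanguage).subset <| by
      rintro _ ⟨u, hu, rfl⟩
      exact ⟨u, hu, rfl⟩
  refine (mem_booleanSubalgebra_closure_iff_of_finite hfinite).trans
    (forall₂_congr fun v w => imp_congr_left ⟨fun h u hu => ?_, ?_⟩)
  · rw [← mem_pieceLanguage_iff_sublist, ← mem_pieceLanguage_iff_sublist]
    exact h _ ⟨u, hu, rfl⟩
  · rintro h _ ⟨u, hu, rfl⟩
    exact mem_pieceLanguage_iff_sublist.trans ((h u hu).trans mem_pieceLanguage_iff_sublist.symm)

theorem eq_replicate_unit (w : List Unit) : w = List.replicate w.length () :=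
  List.eq_replicate_iff.2 ⟨rfl, fun _ _ => rfl⟩

theorem isKPiecewiseTestable_unit_iff {k : ℕ} {L : Language Unit} :
    IsKPiecewiseTestable k L ↔
      ∀ j, k < j → (List.replicate j () ∈ L ↔ List.replicate k () ∈ L) := by
  have sublist_iff (u w : List Unit) : u.Sublist w ↔ u.length ≤ w.length := by
    rw [eq_replicate_unit u, eq_replicate_unit w, List.replicate_sublist_replicate]
    simp
  simp only [isKPiecewiseTestable_iff_sublist, sublist_iff]
  constructor
  · intro h j hj
    refine h _ _ fun u hu => ?_
    simp only [List.length_replicate]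
    omega
  · intro h v w hvw
    have hlen : v.length = w.length ∨ k ≤ v.length ∧ k ≤ w.length := by
      by_contra! hne
      have hv := hvw (List.replicate (min v.length k) ())
      have hw := hvw (List.replicate (min w.length k) ())
      simp only [List.length_replicate] at hv hw
      omega
    rw [eq_replicate_unit v, eq_replicate_unit w]
    rcases hlen with hlen | ⟨hv, hw⟩
    · rw [hlen]
    · have h' : ∀ j, k ≤ j → (List.replicate j () ∈ L ↔ List.replicate k () ∈ L) := fun j hj =>
        hj.eq_or_lt.elim (fun e => e ▸ Iff.rfl) (h j)
      exact (h' _ hv).trans (h' _ hw).symm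

/-! ### Unary ptNFAs -/

theorem eq_of_eqvGen {α β : Type*} {r : α → α → Prop} {f : α → β} (hf : ∀ a b, r a b → f a = f b)
    {a b : α} (hab : Relation.EqvGen r a b) : f a = f b :=
  Setoid.eqvGen_le (s := Setoid.ker f) hf hab

namespace UnaryNFA

variable {σ : Type*} {A : NFA Unit σ}

/-- The state `q` is reachable from `p` by a walk of `j` transitions. -/
def ReachesIn (A : NFA Unit σ) (j : ℕ) (p q : σ) : Prop :=
  q ∈ A.evalFrom {p} (List.replicate j ())

theorem reachesIn_zero {p q : σ} : ReachesIn A 0 p q ↔ q = p := Iff.rfl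

theorem reachesIn_one {p q : σ} : ReachesIn A 1 p q ↔ q ∈ A.step p () := by
  simp [ReachesIn]

theorem reachesIn_add {i j : ℕ} {p q : σ} :
    ReachesIn A (i + j) p q ↔ ∃ r, ReachesIn A i p r ∧ ReachesIn A j r q := by
  rw [ReachesIn, List.replicate_add, NFA.evalFrom_append, NFA.mem_evalFrom_iff_exists]
  rfl

theorem reachesIn_succ {j : ℕ} {p q : σ} :
    ReachesIn A (j + 1) p q ↔ ∃ r ∈ A.step p (), ReachesIn A j r q := by
  rw [add_comm, reachesIn_add]
  simp only [reachesIn_one]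

theorem reaches_iff_exists_reachesIn {p q : σ} : A.Reaches p q ↔ ∃ j, ReachesIn A j p q :=
  ⟨fun ⟨w, hw⟩ => ⟨w.length, by rwa [ReachesIn, ← eq_replicate_unit w]⟩, fun ⟨_, hj⟩ => ⟨_, hj⟩⟩

theorem reaches_refl (p : σ) : A.Reaches p p := ⟨[], rfl⟩

theorem reaches_trans {p q r : σ} (hpq : A.Reaches p q) (hqr : A.Reaches q r) : A.Reaches p r := by
  rw [reaches_iff_exists_reachesIn] at *
  obtain ⟨i, hi⟩ := hpq
  obtain ⟨j, hj⟩ := hqr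
  exact ⟨i + j, reachesIn_add.2 ⟨q, hi, hj⟩⟩

theorem reaches_of_mem_step {p q : σ} (h : q ∈ A.step p ()) : A.Reaches p q :=
  reaches_iff_exists_reachesIn.2 ⟨1, reachesIn_one.2 h⟩

theorem replicate_mem_accepts_iff {j : ℕ} :
    List.replicate j () ∈ A.accepts ↔ ∃ p ∈ A.start, ∃ q ∈ A.accept, ReachesIn A j p q := by
  simp only [NFA.mem_accepts, NFA.mem_evalFrom_iff_exists (S := A.start)]
  exact ⟨fun ⟨q, hq, p, hp, h⟩ => ⟨p, hp, q, hq, h⟩, fun ⟨p, hp, q, hq, h⟩ => ⟨q, hq, p, hp, h⟩⟩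

theorem graphEdge_loopLetters_iff {p a b : σ} (hp : p ∈ A.step p ()) :
    A.GraphEdge (A.loopLetters p) a b ↔ b ∈ A.step a () :=
  ⟨fun ⟨_, _, h⟩ => h, fun h => ⟨(), hp, h⟩⟩

theorem not_graphEdge_loopLetters {p : σ} (hp : p ∉ A.step p ()) (a b : σ) :
    ¬ A.GraphEdge (A.loopLetters p) a b :=
  fun ⟨_, h, _⟩ => hp h

theorem ReachesIn.reflTransGen {p : σ} (hp : p ∈ A.step p ()) {j : ℕ} {a b : σ}
    (h : ReachesIn A j a b) : Relation.ReflTransGen (A.GraphEdge (A.loopLetters p)) a b := by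
  induction j generalizing a with
  | zero => rw [reachesIn_zero.1 h]
  | succ j ih =>
    obtain ⟨r, hr, h⟩ := reachesIn_succ.1 h
    exact .head ((graphEdge_loopLetters_iff hp).2 hr) (ih h)

theorem ReachesIn.eqvGen {p : σ} (hp : p ∈ A.step p ()) {j : ℕ} {a b : σ}
    (h : ReachesIn A j a b) : Relation.EqvGen (A.GraphEdge (A.loopLetters p)) a b :=
  Relation.EqvGen.reflTransGen_le_eqvGen _ _ _ (h.reflTransGen hp)

theorem isMaximalIn_of_loop (h : A.HasUMS) {p q : σ} (hp : p ∈ A.step p ())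
    (hq : q ∈ A.step q ()) : A.IsMaximalIn (A.loopLetters p) q := by
  intro r hr
  refine (h q q (.refl q)).2 rfl r (Relation.ReflTransGen.mono (fun a b hab => ?_) _ _ hr)
  exact (graphEdge_loopLetters_iff hq).2 ((graphEdge_loopLetters_iff hp).1 hab)

theorem eq_of_reachesIn_of_loop (h : A.HasUMS) {i j : ℕ} {p q r : σ} (hpq : ReachesIn A i p q)
    (hpr : ReachesIn A j p r) (hq : q ∈ A.step q ()) (hr : r ∈ A.step r ()) : r = q :=
  (h q r (.trans _ _ _ (.symm _ _ (hpq.eqvGen hq)) (hpr.eqvGen hq))).1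
    (isMaximalIn_of_loop h hq hr)

theorem exists_reachesIn (h : A.IsComplete) (j : ℕ) (p : σ) : ∃ q, ReachesIn A j p q := by
  induction j generalizing p with
  | zero => exact ⟨p, rfl⟩
  | succ j ih =>
    obtain ⟨r, hr⟩ := h p ()
    obtain ⟨q, hq⟩ := ih r
    exact ⟨q, reachesIn_succ.2 ⟨r, hr, hq⟩⟩

theorem not_loop_of_reachesIn (h : A.HasUMS) {j : ℕ} {p q : σ} (hpq : ReachesIn A j p q)
    (hq : q ∉ A.step q ()) : p ∉ A.step p () := by
  intro hp
  obtain rfl : q = p := (h p p (.refl p)).2 rfl q (hpq.reflTransGen hp)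
  exact hq hp

theorem reaches_of_isChain {p q : σ} {l : List σ}
    (h : (p :: l).IsChain (A.GraphEdge Set.univ)) (hq : q ∈ p :: l) : A.Reaches p q := by
  have : IsTrans σ A.Reaches := ⟨fun _ _ _ => reaches_trans⟩
  have hchain : (p :: l).IsChain A.Reaches := h.imp fun _ _ ⟨_, _, h⟩ => reaches_of_mem_step h
  rcases List.mem_cons.1 hq with rfl | hq
  · exact reaches_refl q
  · exact hchain.rel_cons hq

theorem exists_simple_path (h : A.IsPtNFA) {j : ℕ} {p q : σ} (hpq : ReachesIn A j p q)
    (hq : q ∉ A.step q ()) :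
    ∃ l, (p :: l).Nodup ∧ (p :: l).IsChain (A.GraphEdge Set.univ) ∧ l.length = j + 1 := by
  induction j generalizing p with
  | zero =>
    obtain rfl := reachesIn_zero.1 hpq
    obtain ⟨r, hr⟩ := h.2.1 q ()
    have hne : q ≠ r := fun e => hq (e ▸ hr)
    exact ⟨[r], by simpa using hne,
      List.isChain_cons_cons.2 ⟨⟨(), trivial, hr⟩, List.isChain_singleton _⟩, rfl⟩
  | succ j ih =>
    have hp := not_loop_of_reachesIn h.2.2 hpq hq
    obtain ⟨s, hs, hsq⟩ := reachesIn_succ.1 hpq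
    obtain ⟨l, hnodup, hchain, hlength⟩ := ih hsq
    have hps : p ∉ s :: l := fun hmem => hp <| by
      rwa [← h.1.antisymm p s (reaches_of_mem_step hs) (reaches_of_isChain hchain hmem)] at hs
    exact ⟨s :: l, List.nodup_cons.2 ⟨hps, hnodup⟩,
      List.isChain_cons_cons.2 ⟨⟨(), trivial, hs⟩, hchain⟩, by simp [hlength]⟩

theorem loop_of_card_le [Fintype σ] (h : A.IsPtNFA) {j : ℕ} {p q : σ} (hpq : ReachesIn A j p q)
    (hj : Fintype.card σ ≤ j + 1) : q ∈ A.step q () := by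
  by_contra hq
  obtain ⟨l, hnodup, -, hlength⟩ := exists_simple_path h hpq hq
  have := hnodup.length_le_card
  simp only [List.length_cons] at this
  omega

/-- The lengths of the simple paths that start in an initial state; the depth of `A` is their
supremum, which is a junk value if they are unbounded. -/
def simplePathLengths (A : NFA Unit σ) : Set ℕ :=
  {m | ∃ l : List σ, l.Nodup ∧ l.IsChain (A.GraphEdge Set.univ) ∧
    (∃ q ∈ A.start, l.head? = some q) ∧ l.length = m + 1}

theorem bddAbove_simplePathLengths [Finite σ] : BddAbove (simplePathLengths A) := by
  have := Fintype.ofFinite σ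
  refine ⟨Fintype.card σ, ?_⟩
  rintro m ⟨l, hl, -, -, hm⟩
  have := hl.length_le_card
  omega

theorem loop_of_depth_le (h : A.IsPtNFA) (hA : BddAbove (simplePathLengths A)) {j : ℕ} {p q : σ}
    (hp : p ∈ A.start) (hpq : ReachesIn A j p q) (hj : A.depth ≤ j) : q ∈ A.step q () := by
  by_contra hq
  obtain ⟨l, hnodup, hchain, hlength⟩ := exists_simple_path h hpq hq
  have : j + 1 ≤ A.depth :=
    le_csSup hA ⟨p :: l, hnodup, hchain, ⟨p, hp, rfl⟩, congrArg Nat.succ hlength⟩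
  omega

theorem replicate_mem_accepts_iff_of_loop (h : A.IsPtNFA) {m : ℕ}
    (hm : ∀ j, m ≤ j → ∀ p ∈ A.start, ∀ q, ReachesIn A j p q → q ∈ A.step q ()) {j : ℕ}
    (hj : m ≤ j) :
    List.replicate j () ∈ A.accepts ↔ List.replicate m () ∈ A.accepts := by
  have accepts_of_accepts {i j : ℕ} (hi : m ≤ i) (hj : m ≤ j)
      (hacc : List.replicate i () ∈ A.accepts) : List.replicate j () ∈ A.accepts := by
    obtain ⟨p, hp, q, hq, hpq⟩ := replicate_mem_accepts_iff.1 hacc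
    obtain ⟨r, hpr⟩ := exists_reachesIn h.2.1 j p
    obtain rfl := eq_of_reachesIn_of_loop h.2.2 hpq hpr (hm i hi p hp q hpq) (hm j hj p hp r hpr)
    exact replicate_mem_accepts_iff.2 ⟨p, hp, r, hq, hpr⟩
  exact ⟨accepts_of_accepts hj le_rfl, accepts_of_accepts le_rfl hj⟩

theorem isKPiecewiseTestable_iff_depth (h : A.IsPtNFA) (hA : BddAbove (simplePathLengths A))
    (k : ℕ) :
    IsKPiecewiseTestable k A.accepts ↔ ∀ j, k < j → j ≤ A.depth →
      (List.replicate j () ∈ A.accepts ↔ List.replicate k () ∈ A.accepts) := by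
  rw [isKPiecewiseTestable_unit_iff]
  refine ⟨fun hk j hj _ => hk j hj, fun hk j hj => ?_⟩
  have hdepth {j : ℕ} (hj : A.depth ≤ j) :
      List.replicate j () ∈ A.accepts ↔ List.replicate A.depth () ∈ A.accepts :=
    replicate_mem_accepts_iff_of_loop h
      (fun j hj p hp q hpq => loop_of_depth_le h hA hp hpq hj) hj
  rcases le_or_gt j A.depth with hjd | hjd
  · exact hk j hj hjd
  rcases lt_or_ge k A.depth with hkd | hkd
  · rw [hdepth hjd.le, hk A.depth hkd le_rfl]
  · rw [hdepth hjd.le, hdepth hkd]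

theorem isKPiecewiseTestable_iff_of_card_le [Fintype σ] (h : A.IsPtNFA) (k : ℕ) {m : ℕ}
    (hm : Fintype.card σ ≤ m) :
    IsKPiecewiseTestable k A.accepts ↔ ∀ i < m, (List.replicate (min k m + (i + 1)) () ∈ A.accepts ↔
      List.replicate (min k m) () ∈ A.accepts) := by
  rw [isKPiecewiseTestable_unit_iff]
  have hstable {j : ℕ} (hj : m ≤ j) :
      List.replicate j () ∈ A.accepts ↔ List.replicate m () ∈ A.accepts :=
    replicate_mem_accepts_iff_of_loop h
      (fun j hj p _ q hpq => loop_of_card_le h hpq (by omega)) hj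
  rcases le_or_gt m k with hmk | hkm
  · rw [min_eq_right hmk]
    refine iff_of_true (fun j hj => ?_) (fun i _ => hstable (by omega))
    rw [hstable (hmk.trans hj.le), hstable hmk]
  · rw [min_eq_left hkm.le]
    refine ⟨fun hk i _ => hk _ (by omega), fun hk j hj => ?_⟩
    rcases le_or_gt j (k + m) with hjm | hjm
    · obtain ⟨i, rfl⟩ := Nat.exists_eq_add_of_lt hj
      exact hk i (by omega)
    · obtain ⟨i, rfl⟩ := Nat.exists_eq_succ_of_ne_zero (Nat.ne_zero_of_lt hkm)
      rw [← hk i i.lt_succ_self]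
      exact (hstable (by omega)).trans (hstable (by omega)).symm

/-- All walks of length `m` and all walks of length `m + 1` that start in `p` end in `s`, and there
are such walks. -/
def ConvergesTo (A : NFA Unit σ) (m : ℕ) (p s : σ) : Prop :=
  A.evalFrom {p} (List.replicate m ()) = {s} ∧ A.evalFrom {p} (List.replicate (m + 1) ()) = {s}

section ConvergesTo

variable {m : ℕ} {p q s t : σ}

theorem ConvergesTo.step_eq (h : ConvergesTo A m p s) : A.step s () = {s} := by
  have := h.2
  rwa [List.replicate_succ', NFA.evalFrom_append, NFA.evalFrom_singleton,
    h.1, NFA.stepSet_singleton] at this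

theorem evalFrom_of_step_eq (h : A.step s () = {s}) (j : ℕ) :
    A.evalFrom {s} (List.replicate j ()) = {s} := by
  induction j with
  | zero => rfl
  | succ j ih =>
    rw [List.replicate_succ', NFA.evalFrom_append, NFA.evalFrom_singleton, ih,
      NFA.stepSet_singleton, h]

theorem ConvergesTo.evalFrom_add (h : ConvergesTo A m p s) (i : ℕ) :
    A.evalFrom {p} (List.replicate (m + i) ()) = {s} := by
  rw [List.replicate_add, NFA.evalFrom_append, h.1, evalFrom_of_step_eq h.step_eq]

theorem ConvergesTo.eq_of_mem_step (h : ConvergesTo A m p s) (h' : ConvergesTo A m q t)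
    (hpq : q ∈ A.step p ()) : s = t := by
  have : ReachesIn A (m + 1) p t := reachesIn_succ.2 ⟨q, hpq, h'.1.ge rfl⟩
  exact (h.2.le this).symm

theorem ConvergesTo.eq_of_loop (h : ConvergesTo A m p s) (hp : p ∈ A.step p ()) : s = p := by
  have hstay (j : ℕ) : ReachesIn A j p p := by
    induction j with
    | zero => rfl
    | succ j ih => exact reachesIn_succ.2 ⟨p, hp, ih⟩
  exact (h.1.le (hstay m)).symm

theorem isComplete_of_convergesTo {f : σ → σ} (h : ∀ p, ConvergesTo A m p (f p)) :
    A.IsComplete := by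
  intro p _
  obtain ⟨r, hr, -⟩ := reachesIn_succ.1 ((h p).2.ge rfl : ReachesIn A (m + 1) p (f p))
  exact ⟨r, hr⟩

theorem isPartiallyOrdered_of_convergesTo {f : σ → σ} (h : ∀ p, ConvergesTo A m p (f p)) :
    A.IsPartiallyOrdered := by
  refine { refl := reaches_refl, trans := fun _ _ _ => reaches_trans, antisymm := ?_ }
  intro p q hpq hqp
  obtain ⟨i, hi⟩ := reaches_iff_exists_reachesIn.1 hpq
  obtain ⟨j, hj⟩ := reaches_iff_exists_reachesIn.1 hqp
  obtain rfl | hpos := Nat.eq_zero_or_pos i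
  · exact (reachesIn_zero.1 hi).symm
  have hcycle (c : ℕ) : ReachesIn A (c * (i + j)) p p := by
    induction c with
    | zero => rw [Nat.zero_mul]; rfl
    | succ c ih =>
      rw [Nat.succ_mul]
      exact reachesIn_add.2 ⟨p, ih, reachesIn_add.2 ⟨q, hi, hj⟩⟩
  have hp : p = f p := by
    have hm : m ≤ m * (i + j) := Nat.le_mul_of_pos_right m (by omega)
    have hlimit := (h p).evalFrom_add (m * (i + j) - m)
    rw [Nat.add_sub_cancel' hm] at hlimit
    exact hlimit.le (hcycle m)
  have hq : q = p := (evalFrom_of_step_eq (hp ▸ (h p).step_eq) i).le hi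
  exact hq.symm

theorem hasUMS_of_convergesTo {f : σ → σ} (h : ∀ p, ConvergesTo A m p (f p)) : A.HasUMS := by
  intro p q hpq
  have hmax : A.IsMaximalIn (A.loopLetters p) p := by
    intro r hr
    induction hr with
    | refl => rfl
    | tail _ hedge ih =>
      obtain ⟨_, hp, hstep⟩ := ih ▸ hedge
      rw [← (h p).eq_of_loop hp, (h p).step_eq] at hstep
      exact hstep.trans ((h p).eq_of_loop hp)
  refine ⟨fun hq => ?_, fun e => e ▸ hmax⟩
  by_cases hp : p ∈ A.step p ()
  · have hfq : f q = q := hq (f q) (ReachesIn.reflTransGen (j := m) hp ((h q).1.ge rfl))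
    have hfpq : f p = f q := eq_of_eqvGen (fun a b hab =>
      (h a).eq_of_mem_step (h b) ((graphEdge_loopLetters_iff hp).1 hab)) hpq
    rw [← hfq, ← hfpq, (h p).eq_of_loop hp]
  · exact (eq_of_eqvGen (f := id) (fun a b hab => (not_graphEdge_loopLetters hp a b hab).elim)
      hpq).symm

end ConvergesTo

theorem isPtNFA_iff_forall_exists_convergesTo [Fintype σ] {m : ℕ} (hm : Fintype.card σ ≤ m) :
    A.IsPtNFA ↔ ∀ p, ∃ s, ConvergesTo A m p s := by
  constructor
  · intro h p
    obtain ⟨s, hs⟩ := exists_reachesIn h.2.1 m p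
    have hloop := loop_of_card_le h hs (by omega)
    have hlimit {j : ℕ} (hj : m ≤ j) : A.evalFrom {p} (List.replicate j ()) = {s} := by
      refine Set.eq_singleton_iff_nonempty_unique_mem.2 ⟨exists_reachesIn h.2.1 j p, fun q hq => ?_⟩
      exact eq_of_reachesIn_of_loop h.2.2 hs hq hloop (loop_of_card_le h hq (by omega))
    exact ⟨s, hlimit le_rfl, hlimit m.le_succ⟩
  · intro h
    choose f hf using h
    exact ⟨isPartiallyOrdered_of_convergesTo hf, isComplete_of_convergesTo hf,
      hasUMS_of_convergesTo hf⟩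

end UnaryNFA

/-! ### Loop programs and their execution by Turing machines -/

/-- A configuration reaches another one in at most `T` steps of a transition function. -/
def StepsWithin {C : Type*} (f : C → Option C) (T : ℕ) (a b : C) : Prop :=
  Nonempty (StateTransition.EvalsToInTime f a (some b) T)

namespace StepsWithin

variable {C : Type*} {f : C → Option C} {a b c : C} {T T' : ℕ}

theorem refl (a : C) : StepsWithin f 0 a a := ⟨.refl f a⟩

theorem trans (h : StepsWithin f T a b) (h' : StepsWithin f T' b c) :
    StepsWithin f (T + T') a c := by
  obtain ⟨h⟩ := h
  obtain ⟨h'⟩ := h'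
  exact ⟨add_comm T T' ▸ h.trans f T T' a b (some c) h'⟩

theorem single (h : f a = some b) : StepsWithin f 1 a b := ⟨⟨1, h⟩, le_rfl⟩

theorem mono (h : StepsWithin f T a b) (hT : T ≤ T') : StepsWithin f T' a b :=
  h.map fun h => ⟨h.1, h.2.trans hT⟩

end StepsWithin

/-- Programs that work on a family of stacks of symbols from `Γ`, indexed by `W`. There are no
variables: `pop k p` pops a symbol `a` from the stack `k` and continues with `p (some a)`, or with
`p none` if the stack is empty. A loop is repeated as many times as the input has symbols. -/
inductive LoopProgram (W Γ : Type) : Type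
  | skip
  | push (k : W) (a : Γ)
  | pop (k : W) (p : Option Γ → LoopProgram W Γ)
  | seq (p q : LoopProgram W Γ)
  | loop (p : LoopProgram W Γ)

namespace LoopProgram

variable {W Γ : Type}

section Semantics

variable [DecidableEq W]

/-- The effect of a program on the stacks, where `n` is the number of repetitions of all loops. -/
def eval (n : ℕ) : LoopProgram W Γ → (W → List Γ) → W → List Γ
  | skip, s => s
  | push k a, s => Function.update s k (a :: s k)
  | pop k p, s => (p (s k).head?).eval n (Function.update s k (s k).tail)
  | seq p q, s => q.eval n (p.eval n s)
  | loop p, s => (p.eval n)^[n] s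

variable [Fintype Γ]

/-- A bound for the running time of a program on a Turing machine, in terms of the number of
repetitions of all loops. -/
noncomputable def cost : LoopProgram W Γ → Polynomial ℕ
  | skip => 1
  | push _ _ => 1
  | pop _ p => 1 + ∑ a, (p a).cost
  | seq p q => p.cost + q.cost
  | loop p => .X * p.cost + 2 * .X + 2

theorem length_eval_le (n : ℕ) (p : LoopProgram W Γ) (s : W → List Γ) (k : W) :
    (p.eval n s k).length ≤ (s k).length + p.cost.eval n := by
  induction p generalizing s with
  | skip => exact Nat.le_add_right _ _
  | push l a =>
    simp only [eval, cost, Function.update_apply, Polynomial.eval_one]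
    split_ifs with h
    · simp [h]
    · omega
  | pop l p ih =>
    have hterm : (p (s l).head?).cost.eval n ≤ ∑ a, (p a).cost.eval n :=
      Finset.single_le_sum_of_canonicallyOrdered (f := fun a => (p a).cost.eval n)
        (Finset.mem_univ _)
    have hpop : (Function.update s l (s l).tail k).length ≤ (s k).length := by
      rw [Function.update_apply]
      split_ifs with h
      · simp [h]
      · rfl
    have := ih (s l).head? (Function.update s l (s l).tail)
    simp only [eval, cost, Polynomial.eval_add, Polynomial.eval_one, Polynomial.eval_finsetSum]
    omega
  | seq p q ihp ihq =>
    have hp := ihp s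
    have hq := ihq (p.eval n s)
    simp only [eval, cost, Polynomial.eval_add]
    omega
  | loop p ih =>
    have hiterate (i : ℕ) : ((p.eval n)^[i] s k).length ≤ (s k).length + i * p.cost.eval n := by
      induction i with
      | zero => simp
      | succ i ihi =>
        have := ih ((p.eval n)^[i] s)
        rw [Function.iterate_succ_apply', Nat.succ_mul]
        omega
    have := hiterate n
    simp only [eval, cost, Polynomial.eval_add, Polynomial.eval_mul, Polynomial.eval_X]
    omega

end Semantics

/-- The stacks of a machine that runs a program: the input and the output, the stacks of the
program, and for each label a clock, of which only the clocks of loops are used. A clock is a pair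
of stacks whose heights are the numbers of the remaining and of the elapsed repetitions. -/
inductive Stack (W L : Type) : Type
  | input
  | output
  | work (k : W)
  | remaining (l : L)
  | elapsed (l : L)
  deriving DecidableEq, Fintype

/-- The alphabet of a stack. -/
abbrev Symbol (Γ : Type) {W L : Type} : Stack W L → Type
  | .output => Bool
  | _ => Γ

/-- The statements of a machine that runs a program. The internal state of the machine is the last
symbol read. -/
abbrev Code (W Γ L : Type) : Type :=
  Turing.TM2.Stmt (K := Stack W L) (Symbol Γ) L (Option Γ)

/-- The labels of the machine code of a program. A loop has the labels `inl true` for the start of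
an iteration and `inl false` for resetting its clock. -/
def Label : LoopProgram W Γ → Type
  | skip => Unit
  | push _ _ => Unit
  | pop _ p => Option (Σ a, (p a).Label)
  | seq p q => p.Label ⊕ q.Label
  | loop p => Bool ⊕ p.Label

instance [Finite Γ] (p : LoopProgram W Γ) : Finite p.Label := by
  induction p with
  | skip => exact inferInstanceAs (Finite Unit)
  | push k a => exact inferInstanceAs (Finite Unit)
  | pop k p ih => exact inferInstanceAs (Finite (Option (Σ a, (p a).Label)))
  | seq p q ihp ihq => exact inferInstanceAs (Finite (p.Label ⊕ q.Label))
  | loop p ih => exact inferInstanceAs (Finite (Bool ⊕ p.Label))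

/-- The label at which the machine code of a program starts. -/
def entry : (p : LoopProgram W Γ) → p.Label
  | skip => ()
  | push _ _ => ()
  | pop _ _ => none
  | seq p _ => Sum.inl p.entry
  | loop _ => Sum.inl true

/-- Advances the clock of `l` and continues at `again`, or at `done` if no repetition remains. -/
def advanceClock [Inhabited Γ] {L : Type} (l again done : L) : Code W Γ L :=
  .pop (.remaining l) (fun _ a => a) <| .branch Option.isSome
    (.push (.elapsed l) (fun _ => default) (.goto fun _ => again)) (.goto fun _ => done)

/-- Sets back the clock of `l` and continues at `again`, or at `done` if no repetition has
elapsed. -/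
def rewindClock [Inhabited Γ] {L : Type} (l again done : L) : Code W Γ L :=
  .pop (.elapsed l) (fun _ a => a) <| .branch Option.isSome
    (.push (.remaining l) (fun _ => default) (.goto fun _ => again)) (.goto fun _ => done)

/-- The machine code of a program as a part of a larger machine: `emb` maps the labels of the
program to those of the machine, and the code finally jumps to `exit`. -/
def code [Inhabited Γ] {L : Type} :
    (p : LoopProgram W Γ) → (emb : p.Label → L) → (exit : L) → p.Label → Code W Γ L
  | skip, _, exit, _ => .goto fun _ => exit
  | push k a, _, exit, _ => .push (.work k) (fun _ => a) (.goto fun _ => exit)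
  | pop k p, emb, _, none =>
    .pop (.work k) (fun _ a => a) (.goto fun a => emb (some ⟨a, (p a).entry⟩))
  | pop _ p, emb, exit, some ⟨a, l⟩ => (p a).code (fun l => emb (some ⟨a, l⟩)) exit l
  | seq p q, emb, _, .inl l => p.code (fun l => emb (.inl l)) (emb (.inr q.entry)) l
  | seq _ q, emb, exit, .inr l => q.code (fun l => emb (.inr l)) exit l
  | loop p, emb, _, .inl true =>
    advanceClock (emb (.inl true)) (emb (.inr p.entry)) (emb (.inl false))
  | loop _, emb, exit, .inl false => rewindClock (emb (.inl true)) (emb (.inl false)) exit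
  | loop p, emb, _, .inr l => p.code (fun l => emb (.inr l)) (emb (.inl true)) l

/-- The contents of the stacks of the machine while it runs a program: `s` are the contents of the
stacks of the program, and `c l` is the number of elapsed repetitions on the clock of `l`. -/
def contents [Inhabited Γ] {L : Type} (n : ℕ) (s : W → List Γ) (c : L → ℕ) :
    (k : Stack W L) → List (Symbol Γ k)
  | .input => []
  | .output => []
  | .work k => s k
  | .remaining l => List.replicate (n - c l) default
  | .elapsed l => List.replicate (c l) default

theorem stepsWithin_of_stepAux {L : Type} [DecidableEq L] [DecidableEq W] {M : L → Code W Γ L}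
    {l : L} {q : Code W Γ L} {v : Option Γ} {S : (k : Stack W L) → List (Symbol Γ k)}
    {b : Turing.TM2.Cfg (Symbol Γ) L (Option Γ)} (hl : M l = q)
    (h : Turing.TM2.stepAux q v S = b) :
    StepsWithin (Turing.TM2.step M) 1 ⟨some l, v, S⟩ b :=
  .single (by rw [Turing.TM2.step, hl, h])

section Correctness

variable [Inhabited Γ] {L : Type} [DecidableEq L]

section Clock

variable [DecidableEq W]

theorem contents_update_work (n : ℕ) (s : W → List Γ) (c : L → ℕ) (k : W) (x : List Γ) :
    contents n (Function.update s k x) c = Function.update (contents n s c) (.work k) x := by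
  refine (Function.update_eq_iff.2 ⟨by simp [contents], fun j hj => ?_⟩).symm
  cases j with
  | work j => exact (Function.update_of_ne (ne_of_apply_ne Stack.work hj) x s).symm
  | _ => rfl

theorem contents_update_clock (n : ℕ) (s : W → List Γ) (c : L → ℕ) (l : L) (i : ℕ) :
    contents n s (Function.update c l i) =
      Function.update (Function.update (contents n s c) (.remaining l)
        (List.replicate (n - i) default)) (.elapsed l) (List.replicate i default) := by
  refine (Function.update_eq_iff.2 ⟨by simp [contents], fun j hj => ?_⟩).symm
  by_cases hr : j = .remaining l
  · subst hr
    simp [contents]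
  · rw [Function.update_of_ne hr]
    cases j with
    | remaining j => simp [contents, Function.update_of_ne (ne_of_apply_ne Stack.remaining hr)]
    | elapsed j => simp [contents, Function.update_of_ne (ne_of_apply_ne Stack.elapsed hj)]
    | _ => rfl

variable {n i : ℕ} {l again done : L} {v : Option Γ} {s : W → List Γ} {c : L → ℕ}

theorem stepAux_advanceClock (h : i < n) :
    Turing.TM2.stepAux (advanceClock l again done) v (contents n s (Function.update c l i)) =
      ⟨some again, some default, contents n s (Function.update c l (i + 1))⟩ := by
  obtain ⟨j, rfl⟩ := Nat.exists_eq_add_of_lt h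
  have hi : i + j + 1 - i = j + 1 := by omega
  have hi' : i + j + 1 - (i + 1) = j := by omega
  simp only [advanceClock, contents_update_clock, hi, hi', List.replicate_succ]
  simp [Turing.TM2.stepAux, Function.update_comm (a := Stack.elapsed l)]

theorem stepAux_advanceClock_self :
    Turing.TM2.stepAux (advanceClock l again done) v (contents n s (Function.update c l n)) =
      ⟨some done, none, contents n s (Function.update c l n)⟩ := by
  simp [advanceClock, contents_update_clock]

theorem stepAux_rewindClock (h : i < n) :
    Turing.TM2.stepAux (rewindClock l again done) v (contents n s (Function.update c l (i + 1))) =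
      ⟨some again, some default, contents n s (Function.update c l i)⟩ := by
  obtain ⟨j, rfl⟩ := Nat.exists_eq_add_of_lt h
  have hi : i + j + 1 - i = j + 1 := by omega
  have hi' : i + j + 1 - (i + 1) = j := by omega
  simp only [rewindClock, contents_update_clock, hi, hi', List.replicate_succ]
  simp [Turing.TM2.stepAux, Function.update_comm (a := Stack.elapsed l)]

theorem stepAux_rewindClock_zero :
    Turing.TM2.stepAux (rewindClock l again done) v (contents n s (Function.update c l 0)) =
      ⟨some done, none, contents n s (Function.update c l 0)⟩ := by
  simp [rewindClock, contents_update_clock]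

variable {M : L → Code W Γ L}

theorem stepsWithin_iterate {body reset : L} {f : (W → List Γ) → W → List Γ} {C j : ℕ}
    (hl : M l = advanceClock l body reset)
    (hbody : ∀ i v s, ∃ v', StepsWithin (Turing.TM2.step M) C
      ⟨some body, v, contents n s (Function.update c l i)⟩
      ⟨some l, v', contents n (f s) (Function.update c l i)⟩)
    (hij : i + j = n) :
    StepsWithin (Turing.TM2.step M) (j * (C + 1) + 1)
      ⟨some l, v, contents n s (Function.update c l i)⟩
      ⟨some reset, none, contents n (f^[j] s) (Function.update c l n)⟩ := by
  induction j generalizing i v s with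
  | zero =>
    obtain rfl : i = n := hij
    simpa using stepsWithin_of_stepAux hl stepAux_advanceClock_self
  | succ j ih =>
    obtain ⟨v', hv'⟩ := hbody (i + 1) (some default) s
    have hadvance := stepsWithin_of_stepAux hl
      (stepAux_advanceClock (v := v) (s := s) (c := c) (by omega : i < n))
    exact ((hadvance.trans hv').trans (ih (by omega))).mono (by ring_nf; rfl)

theorem stepsWithin_reset {exit reset : L} (hl : M reset = rewindClock l reset exit) (hi : i ≤ n) :
    StepsWithin (Turing.TM2.step M) (i + 1)
      ⟨some reset, v, contents n s (Function.update c l i)⟩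
      ⟨some exit, none, contents n s (Function.update c l 0)⟩ := by
  induction i generalizing v with
  | zero => exact stepsWithin_of_stepAux hl stepAux_rewindClock_zero
  | succ i ih =>
    exact ((stepsWithin_of_stepAux hl (stepAux_rewindClock hi)).trans (ih (by omega))).mono
      (by omega)

theorem stepsWithin_loop {body reset exit : L} {f : (W → List Γ) → W → List Γ} {C : ℕ}
    (hl : M l = advanceClock l body reset) (hreset : M reset = rewindClock l reset exit)
    (hbody : ∀ i v s, ∃ v', StepsWithin (Turing.TM2.step M) C
      ⟨some body, v, contents n s (Function.update c l i)⟩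
      ⟨some l, v', contents n (f s) (Function.update c l i)⟩)
    (hc : c l = 0) :
    StepsWithin (Turing.TM2.step M) (n * (C + 1) + 1 + (n + 1)) ⟨some l, v, contents n s c⟩
      ⟨some exit, none, contents n (f^[n] s) c⟩ := by
  have hc' : Function.update c l 0 = c := Function.update_eq_self_iff.2 hc.symm
  have hrepeat := stepsWithin_iterate (v := v) (s := s) hl hbody (zero_add n)
  have hrewind := stepsWithin_reset (n := n) (v := none) (s := f^[n] s) (c := c) hreset le_rfl
  rw [hc'] at hrepeat hrewind
  exact hrepeat.trans hrewind

end Clock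

variable [DecidableEq W] [Fintype Γ]

theorem stepsWithin_code {M : L → Code W Γ L} (n : ℕ) (p : LoopProgram W Γ) {emb : p.Label → L}
    {exit : L} (hM : ∀ l, M (emb l) = p.code emb exit l) (hemb : emb.Injective) (v : Option Γ)
    (s : W → List Γ) {c : L → ℕ} (hc : ∀ l, c (emb l) = 0) :
    ∃ v', StepsWithin (Turing.TM2.step M) (p.cost.eval n)
      ⟨some (emb p.entry), v, contents n s c⟩ ⟨some exit, v', contents n (p.eval n s) c⟩ := by
  induction p generalizing exit v s c with
  | skip =>
    refine ⟨v, ?_⟩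
    rw [cost, Polynomial.eval_one]
    exact stepsWithin_of_stepAux (hM ()) rfl
  | push k a =>
    refine ⟨v, ?_⟩
    rw [cost, Polynomial.eval_one, eval, contents_update_work]
    exact stepsWithin_of_stepAux (hM ()) rfl
  | pop k p ih =>
    obtain ⟨v', hv'⟩ := ih (s k).head? (emb := fun l => emb (some ⟨_, l⟩)) (fun l => hM _)
      (hemb.comp <| (Option.some_injective _).comp sigma_mk_injective) (s k).head?
      (Function.update s k (s k).tail) (fun l => hc _)
    have hpop : StepsWithin (Turing.TM2.step M) 1 ⟨some (emb none), v, contents n s c⟩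
        ⟨some (emb (some ⟨_, (p (s k).head?).entry⟩)), (s k).head?,
          contents n (Function.update s k (s k).tail) c⟩ :=
      stepsWithin_of_stepAux (hM none) (by rw [contents_update_work]; rfl)
    refine ⟨v', (hpop.trans hv').mono ?_⟩
    rw [cost, Polynomial.eval_add, Polynomial.eval_one, Polynomial.eval_finsetSum]
    exact Nat.add_le_add_left (Finset.single_le_sum_of_canonicallyOrdered
      (f := fun a => (p a).cost.eval n) (Finset.mem_univ _)) _
  | seq p q ihp ihq =>
    obtain ⟨v₁, h₁⟩ := ihp (emb := fun l => emb (.inl l)) (fun l => hM _)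
      (hemb.comp Sum.inl_injective) v s fun l => hc _
    obtain ⟨v₂, h₂⟩ := ihq (emb := fun l => emb (.inr l)) (fun l => hM _)
      (hemb.comp Sum.inr_injective) v₁ (p.eval n s) fun l => hc _
    exact ⟨v₂, (h₁.trans h₂).mono (by rw [cost, Polynomial.eval_add])⟩
  | loop p ih =>
    have hbody (i : ℕ) (v : Option Γ) (s : W → List Γ) :=
      ih (emb := fun l => emb (.inr l)) (fun l => hM _) (hemb.comp Sum.inr_injective) v s
        (c := Function.update c (emb (.inl true)) i)
        (fun l => (Function.update_of_ne (hemb.ne Sum.inr_ne_inl) _ _).trans (hc _))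
    have hloop := stepsWithin_loop (v := v) (s := s) (hM (.inl true)) (hM (.inl false)) hbody (hc _)
    refine ⟨none, hloop.mono ?_⟩
    simp only [cost, Polynomial.eval_add, Polynomial.eval_mul, Polynomial.eval_X,
      Polynomial.eval_ofNat]
    linarith

end Correctness

/-- The phases of a machine that decides a set with a program: it feeds the input to a stack of the
program, fills the clocks, and runs the program; then it writes the answer to the output and clears
all other stacks. -/
inductive Phase : Type
  | feed
  | answer
  | clear
  deriving DecidableEq

instance : Fintype Phase where
  elems := {.feed, .answer, .clear}
  complete := by rintro ⟨⟩ <;> simp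

/-- Increases the number of remaining repetitions on the clocks of `ls`. -/
def windClocks [Inhabited Γ] {L : Type} (ls : List L) (q : Code W Γ L) : Code W Γ L :=
  ls.foldr (fun l q => .push (.remaining l) (fun _ => default) q) q

/-- Pops all stacks of `ks`, and keeps track of whether there was a symbol to be popped. -/
def popAll [Inhabited Γ] {L : Type} (ks : List (Stack W L)) (q : Code W Γ L) : Code W Γ L :=
  ks.foldr (fun k q => .pop k (fun v x => v.or (x.map fun _ => default)) q) q

section Machine

variable [Inhabited Γ] {L : Type} [DecidableEq L] [DecidableEq W]

theorem stepAux_windClocks {ls : List L} (hls : ls.Nodup) (q : Code W Γ L) (v : Option Γ)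
    (S : (k : Stack W L) → List (Symbol Γ k)) :
    Turing.TM2.stepAux (windClocks ls q) v S = Turing.TM2.stepAux q v fun
      | .remaining l => if l ∈ ls then default :: S (.remaining l) else S (.remaining l)
      | k => S k := by
  induction ls generalizing S with
  | nil =>
    congr 1
    funext k
    cases k <;> simp
  | cons l ls ih =>
    obtain ⟨hl, hls⟩ := List.nodup_cons.1 hls
    refine (ih hls _).trans ?_
    congr 1
    funext k
    cases k with
    | remaining j =>
      by_cases hj : j = l
      · subst hj
        simp [hl]
      · simp [hj]
    | _ => simp

theorem stepAux_popAll {ks : List (Stack W L)} (hks : ks.Nodup) (q : Code W Γ L) (v : Option Γ)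
    (S : (k : Stack W L) → List (Symbol Γ k)) :
    ∃ v', Turing.TM2.stepAux (popAll ks q) v S =
        Turing.TM2.stepAux q v' (fun k => if k ∈ ks then (S k).tail else S k) ∧
      (v' = none ↔ v = none ∧ ∀ k ∈ ks, S k = []) := by
  induction ks generalizing v S with
  | nil => exact ⟨v, by simp [popAll], by simp⟩
  | cons k ks ih =>
    obtain ⟨hk, hks⟩ := List.nodup_cons.1 hks
    obtain ⟨v', hv', hnone⟩ := ih hks (v.or ((S k).head?.map fun _ => default))
      (Function.update S k (S k).tail)
    refine ⟨v', hv'.trans ?_, ?_⟩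
    · congr 1
      funext j
      by_cases hj : j = k
      · subst hj
        simp [hk]
      · simp [hj]
    · have hupdate : (∀ j ∈ ks, Function.update S k (S k).tail j = []) ↔ ∀ j ∈ ks, S j = [] :=
        forall₂_congr fun j hj => by rw [Function.update_of_ne (ne_of_mem_of_not_mem hj hk)]
      rw [hnone, hupdate, Option.or_eq_none_iff, Option.map_eq_none_iff, List.head?_eq_none_iff,
        List.forall_mem_cons, and_assoc]

variable [Fintype W] [Fintype L]

/-- The statement that clears all stacks except for the output, by popping them until all of them
are empty. -/
noncomputable def clearStatement (l : L) : Code W Γ L :=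
  popAll (Finset.univ.erase .output).toList
    (.branch Option.isSome (.load (fun _ => none) (.goto fun _ => l)) .halt)

theorem stepAux_clearStatement (l : L) (S : (k : Stack W L) → List (Symbol Γ k)) :
    Turing.TM2.stepAux (clearStatement l) none S =
      if ∀ k ≠ .output, S k = [] then
        ⟨none, none, Function.update (fun _ => []) .output (S .output)⟩
      else ⟨some l, none, fun k => if k = .output then S k else (S k).tail⟩ := by
  obtain ⟨v', hv', hnone⟩ := stepAux_popAll (Finset.univ.erase .output).nodup_toList
    (.branch Option.isSome (.load (fun _ => none) (.goto fun _ => l)) .halt) none S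
  simp only [Finset.mem_toList, Finset.mem_erase, Finset.mem_univ, and_true, true_and]
    at hv' hnone
  rw [clearStatement, hv']
  split_ifs with hS
  · rw [hnone.2 hS]
    simp only [Turing.TM2.stepAux, Option.isSome_none, cond_false]
    congr 1
    funext k
    by_cases hk : k = .output
    · subst hk
      simp
    · simp [hk, hS k hk]
  · rw [Turing.TM2.stepAux, Option.isSome_iff_ne_none.2 (hnone.not.2 hS)]
    simp only [Turing.TM2.stepAux, cond_true, ite_not]

theorem stepsWithin_clear {M : L → Code W Γ L} {l : L} (hl : M l = clearStatement l) {m : ℕ}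
    {S : (k : Stack W L) → List (Symbol Γ k)} (hS : ∀ k ≠ .output, (S k).length ≤ m) :
    StepsWithin (Turing.TM2.step M) (m + 1) ⟨some l, none, S⟩
      ⟨none, none, Function.update (fun _ => []) .output (S .output)⟩ := by
  have hstep := stepsWithin_of_stepAux hl (stepAux_clearStatement l S)
  induction m generalizing S with
  | zero =>
    rwa [if_pos fun k hk => List.eq_nil_of_length_eq_zero (Nat.le_zero.1 (hS k hk))] at hstep
  | succ m ih =>
    split_ifs at hstep
    · exact hstep.mono (by omega)
    · refine (hstep.trans (ih ?_ (stepsWithin_of_stepAux hl (stepAux_clearStatement l _)))).mono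
        (by omega)
      intro k hk
      have := hS k hk
      simp only [if_neg hk, List.length_tail]
      omega

end Machine

section Decide

variable [DecidableEq W] [Fintype W] [Fintype Γ] [Inhabited Γ]

open Classical in
noncomputable instance (p : LoopProgram W Γ) : DecidableEq p.Label := inferInstance

noncomputable instance (p : LoopProgram W Γ) : Fintype p.Label := Fintype.ofFinite _

/-- The machine that decides a set with the program `p`, which gets the reversed input on the stack
`t` and accepts by leaving the stack `o` empty. -/
noncomputable def machineCode (p : LoopProgram W Γ) (t o : W) :
    Phase ⊕ p.Label → Code W Γ (Phase ⊕ p.Label)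
  | .inl .feed => .pop .input (fun _ a => a) <| .branch Option.isSome
      (.push (.work t) (fun v => v.getD default) <|
        windClocks Finset.univ.toList (.goto fun _ => .inl .feed))
      (.goto fun _ => .inr p.entry)
  | .inl .answer => .pop (.work o) (fun _ a => a) <| .push .output Option.isNone <|
      .load (fun _ => none) (.goto fun _ => .inl .clear)
  | .inl .clear => clearStatement (.inl .clear)
  | .inr l => p.code .inr (.inl .answer) l

/-- The Turing machine with the code `machineCode p t o`. -/
noncomputable def machine (p : LoopProgram W Γ) (t o : W) : Turing.FinTM2 where
  K := Stack W (Phase ⊕ p.Label)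
  k₀ := .input
  k₁ := .output
  Γ := Symbol Γ
  Λ := Phase ⊕ p.Label
  main := .inl .feed
  σ := Option Γ
  initialState := none
  Γk₀Fin := inferInstanceAs (Fintype Γ)
  m := machineCode p t o

theorem stepsWithin_feed (p : LoopProgram W Γ) (t o : W) (v : Option Γ) (x y : List Γ) :
    StepsWithin (Turing.TM2.step (machineCode p t o)) (x.length + 1)
      ⟨some (.inl .feed), v, Function.update (contents y.length
        (Function.update (fun _ => []) t y) fun _ => 0) .input x⟩
      ⟨some (.inr p.entry), none, contents (x.reverse ++ y).length
        (Function.update (fun _ => []) t (x.reverse ++ y)) fun _ => 0⟩ := by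
  induction x generalizing v y with
  | nil =>
    exact stepsWithin_of_stepAux rfl (by simp [machineCode, contents])
  | cons a x ih =>
    have hfeed : Turing.TM2.stepAux (machineCode p t o (.inl .feed)) v
        (Function.update (contents y.length (Function.update (fun _ => []) t y) fun _ => 0)
          .input (a :: x)) = ⟨some (.inl .feed), some a, Function.update
            (contents (a :: y).length (Function.update (fun _ => []) t (a :: y)) fun _ => 0)
            .input x⟩ := by
      simp only [machineCode, Turing.TM2.stepAux, Function.update_self, List.head?_cons,
        List.tail_cons, Option.isSome_some, cond_true, Option.getD_some,
        stepAux_windClocks (Finset.nodup_toList _), Finset.mem_toList, Finset.mem_univ, if_true]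
      congr 1
      funext k
      cases k with
      | work k =>
        by_cases hk : k = t
        · subst hk
          simp [contents]
        · simp [contents, hk]
      | remaining l => simp [contents, List.replicate_succ]
      | _ => simp [contents]
    rw [List.reverse_cons, List.append_assoc, List.singleton_append]
    exact ((stepsWithin_of_stepAux rfl hfeed).trans (ih (some a) (a :: y))).mono
      (by rw [List.length_cons]; omega)

theorem stepsWithin_answer (p : LoopProgram W Γ) (t o : W) (v : Option Γ) {n m : ℕ}
    {s : W → List Γ} (hn : n ≤ m) (hs : ∀ k, (s k).length ≤ m) :
    StepsWithin (Turing.TM2.step (machineCode p t o)) (m + 2)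
      ⟨some (.inl .answer), v, contents n s fun _ => 0⟩
      ⟨none, none, Function.update (fun _ => []) .output [(s o).head?.isNone]⟩ := by
  set S := Function.update (Function.update
    (contents n s fun _ : Phase ⊕ p.Label => 0) (.work o) (s o).tail) .output [(s o).head?.isNone]
  have hanswer : StepsWithin (Turing.TM2.step (machineCode p t o)) 1
      ⟨some (.inl .answer), v, contents n s fun _ => 0⟩ ⟨some (.inl .clear), none, S⟩ :=
    stepsWithin_of_stepAux rfl rfl
  have hS (k) (hk : k ≠ .output) : (S k).length ≤ m := by
    simp only [S, Function.update_of_ne hk, ← contents_update_work]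
    cases k with
    | work k =>
      rcases eq_or_ne k o with rfl | hk
      · simpa [contents] using (hs k).trans (Nat.le_succ m)
      · simpa [contents, hk] using hs k
    | _ => simp [contents, hn]
  exact (hanswer.trans (stepsWithin_clear (M := machineCode p t o) rfl hS)).mono (by omega)

theorem stepsWithin_machine (p : LoopProgram W Γ) (t o : W) (x : List Γ) :
    StepsWithin (machine p t o).step
      ((2 * .X + 2 * p.cost + 3 : Polynomial ℕ).eval x.length)
      (Turing.initList (machine p t o) x)
      (Turing.haltList (machine p t o)
        [(p.eval x.length (Function.update (fun _ => []) t x.reverse) o).head?.isNone]) := by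
  have hinit : Turing.initList (machine p t o) x = ⟨some (.inl .feed), none, Function.update
      (contents 0 (Function.update (fun _ => []) t []) fun _ => 0) .input x⟩ := by
    simp only [Turing.initList]
    congr 1
    funext k
    cases k with
    | input => rfl
    | work k => by_cases hk : k = t <;> simp [contents, machine, hk]
    | _ => simp [contents, machine]
  have hhalt (b : Bool) : Turing.haltList (machine p t o) [b] =
      ⟨none, none, Function.update (fun _ => []) .output [b]⟩ := by
    simp only [Turing.haltList]
    congr 1
    funext k
    cases k <;> rfl
  have hfeed := stepsWithin_feed p t o none x []
  rw [List.append_nil, List.length_reverse] at hfeed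
  obtain ⟨v, hrun⟩ := stepsWithin_code (M := machineCode p t o) x.length p (fun _ => rfl)
    Sum.inr_injective none (Function.update (fun _ => []) t x.reverse) (c := fun _ => 0)
    (fun _ => rfl)
  have hlength (k : W) : (p.eval x.length (Function.update (fun _ => []) t x.reverse) k).length ≤
      x.length + p.cost.eval x.length := by
    refine (length_eval_le _ _ _ _).trans (Nat.add_le_add_right ?_ _)
    by_cases hk : k = t <;> simp [hk]
  have hanswer := stepsWithin_answer p t o v (Nat.le_add_right _ _) hlength
  rw [hinit, hhalt]
  refine ((hfeed.trans hrun).trans hanswer).mono ?_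
  simp only [Polynomial.eval_add, Polynomial.eval_mul, Polynomial.eval_X, Polynomial.eval_ofNat]
  omega

end Decide

theorem decidableInPolyTime [DecidableEq W] [Finite W] [Finite Γ] [Inhabited Γ]
    (p : LoopProgram W Γ) (t o : W) {X : Type} {encode : X → List Γ} {S : Set X}
    (h : ∀ x, p.eval (encode x).length (Function.update (fun _ => []) t (encode x).reverse) o = [] ↔
      x ∈ S) : DecidableInPolyTime encode S := by
  cases nonempty_fintype W
  cases nonempty_fintype Γ
  refine ⟨fun x => (p.eval (encode x).length
    (Function.update (fun _ => []) t (encode x).reverse) o).head?.isNone, fun x => ?_, ⟨?_⟩⟩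
  · rw [Option.isNone_iff_eq_none, List.head?_eq_none_iff, h]
  · refine
      { tm := machine p t o
        inputAlphabet := Equiv.refl Γ
        outputAlphabet := Equiv.refl Bool
        time := 2 * .X + 2 * p.cost + 3
        outputsFun := fun x => ?_ }
    have hx : (encode x).map (Equiv.refl Γ).invFun = encode x := List.map_id _
    exact (congrArg (Turing.TM2OutputsInTime (machine p t o) · _ _) hx).mpr
      (Classical.choice (stepsWithin_machine p t o (encode x)))

section DerivedPrograms

/-- Runs programs one after another. -/
def block (ps : List (LoopProgram W Γ)) : LoopProgram W Γ :=
  ps.foldr seq skip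

/-- Pops the symbols of the stack `k` one by one and runs `p a` for each symbol `a`. -/
def forEach (k : W) (p : Γ → LoopProgram W Γ) : LoopProgram W Γ :=
  loop (pop k fun a => a.elim skip p)

/-- Moves the contents of `k` to `l`, which reverses their order. -/
def move (k l : W) : LoopProgram W Γ :=
  forEach k (push l)

/-- Moves the contents of `k` both to `l` and to `m`. -/
def move₂ (k l m : W) : LoopProgram W Γ :=
  forEach k fun a => seq (push l a) (push m a)

/-- Puts a copy of the contents of `k` on `l` by means of the stack `m`, which should be empty. -/
def duplicate (k l m : W) : LoopProgram W Γ :=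
  block [move k m, move₂ m k l]

/-- Continues with `p a`, where `a` is the top symbol of `k`, which is left in place. -/
def peek (k : W) (p : Option Γ → LoopProgram W Γ) : LoopProgram W Γ :=
  pop k fun a => a.elim (p none) fun b => seq (push k b) (p (some b))

/-- Removes the top symbol of `k`. -/
def discardTop (k : W) : LoopProgram W Γ :=
  pop k fun _ => skip

/-- The program does not use the stack `k`. -/
def Avoids (k : W) : LoopProgram W Γ → Prop
  | skip => True
  | push l _ => l ≠ k
  | pop l p => l ≠ k ∧ ∀ a, (p a).Avoids k
  | seq p q => p.Avoids k ∧ q.Avoids k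
  | loop p => p.Avoids k

instance instDecidableAvoids [Fintype Γ] [DecidableEq W] (k : W) :
    (p : LoopProgram W Γ) → Decidable (p.Avoids k)
  | skip => inferInstanceAs (Decidable True)
  | push l _ => inferInstanceAs (Decidable (l ≠ k))
  | pop l p =>
    have (a : Option Γ) : Decidable ((p a).Avoids k) := instDecidableAvoids k (p a)
    inferInstanceAs (Decidable (l ≠ k ∧ ∀ a, (p a).Avoids k))
  | seq p q =>
    have := instDecidableAvoids k p
    have := instDecidableAvoids k q
    inferInstanceAs (Decidable (p.Avoids k ∧ q.Avoids k))
  | loop p => instDecidableAvoids k p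

variable [DecidableEq W] {n : ℕ} {k l m : W} {s : W → List Γ}

theorem eval_update {p : LoopProgram W Γ} (hp : p.Avoids k) (s : W → List Γ) (x : List Γ) :
    p.eval n (Function.update s k x) = Function.update (p.eval n s) k x := by
  induction p generalizing s with
  | skip => rfl
  | push l a =>
    simp only [eval, Function.update_of_ne hp]
    exact Function.update_comm (Ne.symm hp) _ _ _
  | pop l p ih =>
    simp only [eval, Function.update_of_ne hp.1]
    rw [Function.update_comm (Ne.symm hp.1), ih _ (hp.2 _)]
  | seq p q ihp ihq => simp only [eval, ihp hp.1, ihq hp.2]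
  | loop p ih =>
    exact (Function.Semiconj.iterate_right (f := (Function.update · k x))
      (fun s => (ih hp s).symm) n s).symm

@[simp]
theorem eval_block_nil : (block []).eval n s = s :=
  rfl

@[simp]
theorem eval_block_cons (p : LoopProgram W Γ) (ps : List (LoopProgram W Γ)) :
    (block (p :: ps)).eval n s = (block ps).eval n (p.eval n s) :=
  rfl

theorem eval_forEach {p : Γ → LoopProgram W Γ} (hp : ∀ a, (p a).Avoids k)
    (hn : (s k).length ≤ n) :
    (forEach k p).eval n s =
      (s k).foldl (fun t a => (p a).eval n t) (Function.update s k []) := by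
  have hiterate (x : List Γ) (j : ℕ) (s : W → List Γ) (hx : s k = x) (hj : x.length ≤ j) :
      ((pop k fun a => a.elim skip p).eval n)^[j] s =
        x.foldl (fun t a => (p a).eval n t) (Function.update s k []) := by
    induction x generalizing j s with
    | nil =>
      have hs : Function.update s k [] = s := Function.update_eq_self_iff.2 hx.symm
      rw [List.foldl_nil, hs]
      exact Function.iterate_fixed (by simp [eval, hx, hs]) j
    | cons a x ih =>
      obtain ⟨j, rfl⟩ : ∃ j', j = j' + 1 := ⟨j - 1, by rw [List.length_cons] at hj; omega⟩
      have hfirst : (pop k fun a => a.elim skip p).eval n s =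
          Function.update ((p a).eval n s) k x := by
        simp [eval, hx, eval_update (hp a)]
      rw [Function.iterate_succ_apply, hfirst, ih j _ (by simp) (Nat.le_of_succ_le_succ hj)]
      simp [eval_update (hp a)]
  exact hiterate _ n s rfl hn

theorem eval_move (hkl : k ≠ l) (hn : (s k).length ≤ n) :
    (move k l).eval n s =
      Function.update (Function.update s k []) l ((s k).reverse ++ s l) := by
  have hfold (x : List Γ) (t : W → List Γ) :
      x.foldl (fun t a => (push l a).eval n t) t = Function.update t l (x.reverse ++ t l) := by
    induction x generalizing t with
    | nil => simp
    | cons a x ih =>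
      rw [List.foldl_cons, ih]
      simp [eval]
  rw [move, eval_forEach (fun _ => by exact hkl.symm) hn, hfold, Function.update_of_ne hkl.symm]

theorem eval_move₂ (hkl : k ≠ l) (hkm : k ≠ m) (hlm : l ≠ m) (hn : (s k).length ≤ n) :
    (move₂ k l m).eval n s = Function.update (Function.update (Function.update s k [])
      l ((s k).reverse ++ s l)) m ((s k).reverse ++ s m) := by
  have hfold (x : List Γ) (t : W → List Γ) :
      x.foldl (fun t a => (seq (push l a) (push m a)).eval n t) t =
        Function.update (Function.update t l (x.reverse ++ t l)) m (x.reverse ++ t m) := by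
    induction x generalizing t with
    | nil => simp
    | cons a x ih =>
      rw [List.foldl_cons, ih]
      simp [eval, hlm, hlm.symm, Function.update_comm hlm.symm]
  rw [move₂, eval_forEach (fun _ => by exact ⟨hkl.symm, hkm.symm⟩) hn, hfold,
    Function.update_of_ne hkl.symm, Function.update_of_ne hkm.symm]

theorem eval_duplicate (hkl : k ≠ l) (hkm : k ≠ m) (hlm : l ≠ m) (hm : s m = [])
    (hn : (s k).length ≤ n) :
    (duplicate k l m).eval n s = Function.update s l (s k ++ s l) := by
  rw [duplicate, eval_block_cons, eval_block_cons, eval_block_nil, eval_move hkm hn,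
    eval_move₂ hkm.symm hlm.symm hkl (by simpa [hm] using hn)]
  funext i
  by_cases hil : i = l
  · subst hil
    simp [hm, hlm, hkl.symm]
  · by_cases hik : i = k
    · subst hik
      simp [hm, hkm, hkl]
    · by_cases him : i = m
      · subst him
        simp [hm, hlm.symm, hkm.symm]
      · simp [hil, hik, him]

@[simp]
theorem eval_peek (p : Option Γ → LoopProgram W Γ) :
    (peek k p).eval n s = (p (s k).head?).eval n s := by
  cases h : s k <;> simp [peek, eval, h, Function.update_eq_self_iff.2]

@[simp]
theorem eval_discardTop : (discardTop k).eval n s = Function.update s k (s k).tail :=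
  rfl

end DerivedPrograms

end LoopProgram

/-! ### A program for the decision problem -/

namespace UnaryNFA

open Function (update)
open LoopProgram

section BitVectors

/-- Adds the row `l` of a Boolean matrix, multiplied by `x`, to the vector `v`, which is padded with
`false`. -/
def orRow (x : Bool) : List Bool → List Bool → List Bool
  | [], _ => []
  | r :: l, v => (v.headD false || x && r) :: orRow x l v.tail

/-- Adds the product of the vector `X` and the matrix with the given rows to the vector `v`. -/
def orRows : List (List Bool) → List Bool → List Bool → List Bool
  | [], _, v => v
  | l :: rows, X, v => orRows rows X.tail (orRow (X.headD false) l v)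

@[simp]
theorem length_orRow (x : Bool) (l v : List Bool) : (orRow x l v).length = l.length := by
  induction l generalizing v with
  | nil => rfl
  | cons r l ih => simp [orRow, ih]

theorem getD_orRow (x : Bool) {l v : List Bool} (h : v.length ≤ l.length) (i : ℕ) :
    (orRow x l v).getD i false = (v.getD i false || x && l.getD i false) := by
  induction l generalizing v i with
  | nil => simp [orRow, List.eq_nil_of_length_eq_zero (Nat.le_zero.1 h)]
  | cons r l ih =>
    cases i with
    | zero => cases v <;> simp [orRow]
    | succ i => cases v <;> simp_all [orRow]

theorem length_orRows {rows : List (List Bool)} {m : ℕ} (hrows : ∀ l ∈ rows, l.length = m)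
    (hne : rows ≠ []) (X v : List Bool) : (orRows rows X v).length = m := by
  induction rows generalizing X v with
  | nil => exact absurd rfl hne
  | cons l rows ih =>
    rcases eq_or_ne rows [] with rfl | hne'
    · simpa [orRows] using hrows
    · exact ih (fun l hl => hrows l (List.mem_cons_of_mem _ hl)) hne' _ _

theorem getD_orRows {rows : List (List Bool)} {m : ℕ} (hrows : ∀ l ∈ rows, l.length = m)
    {X v : List Bool} (hv : v.length ≤ m) (i : ℕ) :
    (orRows rows X v).getD i false = true ↔ v.getD i false = true ∨
      ∃ p, X.getD p false = true ∧ (rows.getD p []).getD i false = true := by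
  induction rows generalizing X v with
  | nil => simp [orRows]
  | cons l rows ih =>
    have hl : l.length = m := hrows l List.mem_cons_self
    rw [orRows, ih (fun l hl => hrows l (List.mem_cons_of_mem _ hl)) (by simp [hl]),
      getD_orRow _ (hv.trans_eq hl.symm), Bool.or_eq_true, Bool.and_eq_true, or_assoc]
    refine or_congr_right ?_
    constructor
    · rintro (⟨hX, hl⟩ | ⟨p, hX, hp⟩)
      · exact ⟨0, by simpa [List.headD_eq_head?_getD, List.head?_eq_getElem?] using hX, hl⟩
      · exact ⟨p + 1, by simpa using hX, hp⟩
    · rintro ⟨p | p, hX, hp⟩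
      · exact .inl ⟨by simpa [List.headD_eq_head?_getD, List.head?_eq_getElem?] using hX, hp⟩
      · exact .inr ⟨p, by simpa using hX, hp⟩

/-- The unit vector of the coordinate `p`, without the trailing zeros. -/
def unitVector : ℕ → List Bool
  | 0 => [true]
  | p + 1 => false :: unitVector p

@[simp]
theorem length_unitVector (p : ℕ) : (unitVector p).length = p + 1 := by
  induction p with
  | zero => rfl
  | succ p ih => rw [unitVector, List.length_cons, ih]

theorem getD_unitVector (p i : ℕ) : (unitVector p).getD i false = true ↔ i = p := by
  induction p generalizing i with
  | zero => cases i <;> simp [unitVector]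
  | succ p ih =>
    cases i with
    | zero => simp [unitVector]
    | succ i => simpa [unitVector] using ih i

end BitVectors

section Representation

variable {N : ℕ} (A : NFA Unit (Fin N))

open Classical in
/-- The characteristic vector of a set. -/
noncomputable def indicator (S : Set (Fin N)) : List Bool :=
  List.ofFn fun p => decide (p ∈ S)

/-- The list `X`, which may be shorter than a characteristic vector, represents the set `S`. -/
def Represents (X : List Bool) (S : Set (Fin N)) : Prop :=
  X.length ≤ N ∧ ∀ p : Fin N, X.getD p false = true ↔ p ∈ S

open Classical in
/-- The row of a state: is it initial, is it accepting, and its row of the transition matrix. -/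
noncomputable def row (p : Fin N) : List Bool :=
  decide (p ∈ A.start) :: decide (p ∈ A.accept) :: indicator (A.step p ())

/-- The rows of all states. -/
noncomputable def rows : List (List Bool) :=
  List.ofFn (row A)

/-- A matrix on a tape, each row of which is closed by the separator `none`. -/
def encodeRows (rows : List (List Bool)) : List (Option Bool) :=
  rows.flatMap fun l => l.map some ++ [none]

variable {A}

theorem length_indicator (S : Set (Fin N)) : (indicator S).length = N := by
  simp [indicator]

theorem getD_indicator (S : Set (Fin N)) (p : Fin N) :
    (indicator S).getD p false = true ↔ p ∈ S := by
  simp [indicator]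

theorem represents_indicator (S : Set (Fin N)) : Represents (indicator S) S :=
  ⟨(length_indicator S).le, getD_indicator S⟩

theorem count_indicator_eq_one (S : Set (Fin N)) :
    (indicator S).count true = 1 ↔ ∃ s, S = {s} := by
  classical
  have hcount : (indicator S).count true = S.toFinset.card := by
    rw [indicator, List.ofFn_eq_map, List.count, List.countP_map, List.countP_eq_length_filter,
      ← List.toFinset_card_of_nodup ((List.nodup_finRange N).filter _)]
    congr 1
    ext p
    simp
  rw [hcount, Finset.card_eq_one]
  exact exists_congr fun s => by rw [← Finset.coe_inj, Set.coe_toFinset, Finset.coe_singleton]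

theorem represents_unitVector (p : Fin N) : Represents (unitVector p) {p} :=
  ⟨by simp, fun q => by rw [getD_unitVector, Set.mem_singleton_iff, Fin.ext_iff]⟩

theorem length_rows : (rows A).length = N :=
  List.length_ofFn

theorem map_headD_rows : (rows A).map (·.headD false) = indicator A.start := by
  simp [rows, row, indicator, List.map_ofFn, Function.comp_def]

theorem length_of_mem_rows {l : List Bool} (hl : l ∈ rows A) : l.length = N + 2 := by
  obtain ⟨p, rfl⟩ := List.mem_ofFn.1 hl
  simp [row, length_indicator]

theorem eq_indicator {X : List Bool} {S : Set (Fin N)} (hlen : X.length = N)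
    (hX : ∀ p : Fin N, X.getD p false = true ↔ p ∈ S) : X = indicator S := by
  refine List.ext_getElem (hlen.trans (length_indicator S).symm) fun i hi hi' => ?_
  have := (hX ⟨i, hlen ▸ hi⟩).trans (getD_indicator S ⟨i, hlen ▸ hi⟩).symm
  simpa [List.getD_eq_getElem, hi, hi', Bool.coe_iff_coe] using this

theorem indicator_injective : Function.Injective (indicator (N := N)) := fun S T h =>
  Set.ext fun p => by rw [← getD_indicator, h, getD_indicator]

theorem getD_orRows_rows {X : List Bool} {S : Set (Fin N)} (hX : Represents X S) (i : ℕ) :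
    (orRows (rows A) X []).getD i false = true ↔ ∃ p ∈ S, (row A p).getD i false = true := by
  rw [getD_orRows (m := N + 2) (fun _ => length_of_mem_rows) (by simp)]
  simp only [List.getD_nil, Bool.false_eq_true, false_or]
  constructor
  · rintro ⟨p, hp, hpi⟩
    have hpN : p < N := by
      by_contra hpN
      simp [rows, hpN] at hpi
    exact ⟨⟨p, hpN⟩, (hX.2 _).1 hp, by simpa [rows, hpN] using hpi⟩
  · rintro ⟨p, hp, hpi⟩
    exact ⟨p, (hX.2 p).2 hp, by simpa [rows] using hpi⟩

open Classical in
theorem orRows_rows [NeZero N] {X : List Bool} {S : Set (Fin N)} (hX : Represents X S) :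
    ∃ a, orRows (rows A) X [] =
      a :: decide (∃ q ∈ A.accept, q ∈ S) :: indicator (A.stepSet S ()) := by
  have hlen : (orRows (rows A) X []).length = N + 2 :=
    length_orRows (fun _ => length_of_mem_rows)
      (List.ne_nil_of_length_pos (by simp [rows, NeZero.pos])) X []
  have hget := getD_orRows_rows (A := A) hX
  match hv : orRows (rows A) X [], hlen with
  | a :: b :: Y, hlen =>
    rw [hv] at hget
    have hb : b = true ↔ ∃ q ∈ A.accept, q ∈ S := by
      simpa [row, and_comm] using hget 1
    have hY (q : Fin N) : Y.getD q false = true ↔ q ∈ A.stepSet S () := by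
      simpa [row, NFA.mem_stepSet, indicator] using hget (q + 2)
    refine ⟨a, ?_⟩
    rw [eq_indicator (by simpa using hlen) hY, Bool.eq_iff_iff.2 (hb.trans decide_eq_true_iff.symm)]

theorem length_encodeRows {rows : List (List Bool)} {m : ℕ} (hrows : ∀ l ∈ rows, l.length = m) :
    (encodeRows rows).length = rows.length * (m + 1) := by
  induction rows with
  | nil => simp [encodeRows]
  | cons l rows ih =>
    simp_all [encodeRows, Nat.succ_mul]
    omega

theorem length_encodeRows_rows : (encodeRows (rows A)).length = N * (N + 3) := by
  rw [length_encodeRows fun _ => length_of_mem_rows, length_rows]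

theorem encodeInstance_eq (x : UnaryNFA × ℕ) : encodeInstance x =
    (Computability.encodeNat x.2).map some ++ none :: encodeRows (rows x.1.2) := by
  have hrow : encodeState x.1.2 = fun p => (row x.1.2 p).map some ++ [none] := by
    funext p
    simp [encodeState, row, indicator, List.ofFn_eq_map, -List.ofFn_succ]
  simp [encodeInstance, encodeRows, rows, List.ofFn_eq_map, List.flatMap_map, hrow,
    -List.ofFn_succ]

end Representation

section Programs

/-- The stacks of the programs for the decision problem: `rows` holds the rows of the automaton,
`key` the number `k`, least significant bit first, `initial` the set of initial states, `states` one
symbol for each state, `unit` the characteristic vector of a state, and `cur` the current set of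
states. The input is rejected if and only if a symbol is pushed on `fault`. -/
inductive Tape : Type
  | rows
  | rows'
  | key
  | initial
  | states
  | unit
  | cur
  | sum
  | scratch
  | prev
  | flag
  | fault
  deriving DecidableEq

instance : Fintype Tape where
  elems := {.rows, .rows', .key, .initial, .states, .unit, .cur, .sum, .scratch, .prev, .flag,
    .fault}
  complete := by rintro ⟨⟩ <;> simp

/-- Programs on the stacks `Tape`. The symbol `none` is the separator of the input. -/
abbrev Program : Type := LoopProgram Tape (Option Bool)

/-- The contents of the stacks. -/
abbrev Tapes : Type := Tape → List (Option Bool)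

/-- The symbol read is the bit `true`. -/
def isTrue (a : Option (Option Bool)) : Bool :=
  a == some (some true)

/-- Treats one symbol of the matrix in the product of the vector on `cur` and the matrix: the top of
`cur` belongs to the current row, the sum of the products of the previous rows is on `sum`, and its
updated entries are collected on `scratch`. -/
def passSymbol : Option Bool → Program
  | some r => block [.push .rows' (some r), peek .cur fun x => .pop .sum fun y =>
      .push .scratch (some (isTrue y || isTrue x && r))]
  | none => block [.push .rows' none, move .scratch .sum, discardTop .cur]

/-- Replaces the set of states on `cur` by the set of its successors, and then runs `p b`, where
`b` says whether the former set contains an accepting state. -/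
def step (p : Bool → Program) : Program :=
  block [forEach .rows passSymbol, move .rows' .rows, discardTop .sum, .pop .sum fun b =>
    block [move .sum .scratch, move .scratch .cur, p (isTrue b)]]

/-- Replaces the set of states on `cur` by the set of its successors. -/
def pass : Program :=
  step fun _ => skip

/-- Compares the symbol `a` with the top of `prev`, and counts the bits `true` on `flag`. -/
def compareSymbol (a : Option Bool) : Program :=
  block [if a = some true then push .flag none else skip,
    .pop .prev fun b => if b = some a then skip else push .fault none]

/-- Checks that `flag` contains exactly one symbol. -/
def checkUnique : Program :=
  .pop .flag fun a => a.elim (push .fault none) fun _ => move .flag .fault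

/-- Checks that `cur` and `prev` are equal and contain exactly one bit `true`. -/
def compareSets : Program :=
  block [forEach .cur compareSymbol, checkUnique]

/-- Puts on `prev` the set of states reached from the state on `unit` by as many transitions as
loops have repetitions, and on `cur` the set of states reached by one more transition. -/
def runFromUnit : Program :=
  block [duplicate .unit .cur .scratch, loop pass, duplicate .cur .prev .scratch, pass]

/-- Checks that the walks from the state on `unit` of the two lengths considered in `runFromUnit`
all end in the same state, and goes on to the next state. -/
def checkState : Program :=
  block [runFromUnit, compareSets, push .unit (some false)]

/-- Runs `checkState` for all states. -/
def checkStates : Program :=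
  forEach .states fun _ => checkState

/-- Treats one symbol of the input; the last symbol of the matrix is on the top of `rows'`, which is
empty while the number `k` is read. -/
def parseSymbol (a : Option Bool) : Program :=
  peek .rows' fun
    | none => if a = none then push .rows' none else push .scratch a
    | some none => block [push .initial a, push .states none, push .rows' a]
    | some (some _) => push .rows' a

/-- Distributes the input, which is on `scratch` in reversed order, to the stacks, and puts the
characteristic vector of the first state on `unit`. -/
def parse : Program :=
  block [move .scratch .rows, forEach .rows parseSymbol, move .scratch .key, move .rows' .rows,
    discardTop .rows, push .unit (some true)]

/-- Treats one bit in the subtraction of `1` from a number; `flag` holds a symbol as long as there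
is a borrow. -/
def decrementBit (a : Option Bool) : Program :=
  .pop .flag fun
    | none => push .scratch a
    | some _ => if a = some true then push .scratch (some false) else
        block [push .scratch (some true), push .flag none]

/-- If the number on `key` is positive, decreases it by `1` and replaces the set of states on `cur`
by the set of its successors. -/
def advanceStep : Program :=
  block [push .flag none, forEach .key decrementBit, .pop .flag fun a =>
    a.elim (block [move .scratch .key, pass]) fun _ => forEach .scratch fun _ => skip]

/-- Checks that the set of states on `cur` contains an accepting state if and only if its iterated
successors do, for as many iterations as loops have repetitions. -/
def compareWords : Program :=
  step fun b => loop (step fun c => if c = b then skip else push .fault none)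

/-- Checks that the language of the automaton is `k`-piecewise testable, where `k` is the number on
`key`. -/
def checkWords : Program :=
  block [move .initial .cur, loop advanceStep, compareWords]

/-- The program for the decision problem, whose input is on `scratch` in reversed order. -/
def decisionProgram : Program :=
  block [parse, checkStates, checkWords]

end Programs

section Step

variable {n : ℕ} {s : Tapes}

theorem foldl_passSymbol_map_some (l v : List Bool)
    (hv : s .sum = v.map some) :
    (l.map some).foldl (fun t a => (passSymbol a).eval n t) s =
      update (update (update s .rows' ((l.map some).reverse ++ s .rows'))
        .scratch (((orRow (isTrue (s .cur).head?) l v).map some).reverse ++ s .scratch))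
        .sum ((v.drop l.length).map some) := by
  induction l generalizing s v with
  | nil => funext k; cases k <;> simp [hv, orRow]
  | cons r l ih =>
    rw [List.map_cons, List.foldl_cons, ih v.tail]
    · funext k
      cases k <;> cases v <;> simp [passSymbol, eval, orRow, hv, isTrue]
    · simp [passSymbol, eval, hv]

theorem foldl_passSymbol_row {X l v : List Bool} (hX : s .cur = X.map some)
    (hv : s .sum = v.map some) (hvl : v.length ≤ l.length) (hscratch : s .scratch = [])
    (hl : l.length ≤ n) :
    (l.map some ++ [none]).foldl (fun t a => (passSymbol a).eval n t) s =
      update (update (update s .rows' ((l.map some ++ [none]).reverse ++ s .rows'))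
        .cur (X.tail.map some)) .sum ((orRow (X.headD false) l v).map some) := by
  have hhead : isTrue (s .cur).head? = X.headD false := by
    cases X <;> simp [hX, isTrue]
  rw [List.foldl_append, foldl_passSymbol_map_some l v hv, List.foldl_cons, List.foldl_nil,
    List.drop_of_length_le hvl, hhead, hscratch, passSymbol]
  simp only [eval_block_cons, eval_block_nil, eval_discardTop]
  rw [eval_move (by decide) (by simpa [eval] using hl)]
  funext k
  cases k <;> simp [eval, hX, hscratch]

theorem foldl_passSymbol_encodeRows {rows : List (List Bool)} {m : ℕ}
    (hrows : ∀ l ∈ rows, l.length = m) (hm : m ≤ n) {X v : List Bool} (hX : s .cur = X.map some)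
    (hv : s .sum = v.map some) (hvm : v.length ≤ m) (hscratch : s .scratch = []) :
    (encodeRows rows).foldl (fun t a => (passSymbol a).eval n t) s =
      update (update (update s .rows' ((encodeRows rows).reverse ++ s .rows'))
        .cur ((X.drop rows.length).map some)) .sum ((orRows rows X v).map some) := by
  induction rows generalizing s X v with
  | nil =>
    funext k
    cases k <;> simp [encodeRows, orRows, hX, hv]
  | cons l rows ih =>
    have hl : l.length = m := hrows l List.mem_cons_self
    rw [encodeRows, List.flatMap_cons, List.foldl_append,
      foldl_passSymbol_row hX hv (hvm.trans_eq hl.symm) hscratch (hl.trans_le hm), ← encodeRows,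
      ih (X := X.tail) (v := orRow (X.headD false) l v)
        (fun l hl => hrows l (List.mem_cons_of_mem _ hl)) (by simp) (by simp) (by simp [hl])
        (by simpa using hscratch)]
    funext k
    cases k <;> simp [orRows]

variable {N : ℕ} {A : NFA Unit (Fin N)}

/-- The rows of `A` are on the stack `rows`, the loops are long enough to process them, and the
stacks that `step` uses in the meantime are empty. -/
structure Ready (A : NFA Unit (Fin N)) (n : ℕ) (s : Tapes) : Prop where
  length_le : (encodeRows (rows A)).length ≤ n
  rows_eq : s .rows = encodeRows (rows A)
  rows'_eq : s .rows' = []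
  sum_eq : s .sum = []
  scratch_eq : s .scratch = []

theorem Ready.update (hs : Ready A n s) {k : Tape}
    (hk : k ∉ [Tape.rows, .rows', .sum, .scratch]) (x : List (Option Bool)) :
    Ready A n (update s k x) := by
  simp only [List.mem_cons, List.not_mem_nil, or_false, not_or] at hk
  obtain ⟨hrows, hrows', hsum, hscratch⟩ := hk
  exact ⟨hs.length_le, by simp [Ne.symm hrows, hs.rows_eq], by simp [Ne.symm hrows', hs.rows'_eq],
    by simp [Ne.symm hsum, hs.sum_eq], by simp [Ne.symm hscratch, hs.scratch_eq]⟩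

theorem Ready.add_two_le [NeZero N] (hs : Ready A n s) : N + 2 ≤ n := by
  refine le_trans ?_ hs.length_le
  rw [length_encodeRows_rows]
  nlinarith [NeZero.pos N]

open Classical in
theorem eval_step [NeZero N] (hs : Ready A n s) (p : Bool → Program) {X : List Bool}
    {S : Set (Fin N)} (hX : Represents X S) (hcur : s .cur = X.map some) :
    (step p).eval n s = (p (decide (∃ q ∈ A.accept, q ∈ S))).eval n
      (update s .cur ((indicator (A.stepSet S ())).map some)) := by
  obtain ⟨a, ha⟩ := orRows_rows (A := A) hX
  have hN := hs.add_two_le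
  have hmul : (forEach .rows passSymbol).eval n s =
      update (update (update (update s .rows []) .rows' (encodeRows (rows A)).reverse)
        .cur []) .sum ((orRows (rows A) X []).map some) := by
    rw [eval_forEach (by decide) (by simpa [hs.rows_eq] using hs.length_le), hs.rows_eq,
      foldl_passSymbol_encodeRows (m := N + 2) (fun _ => length_of_mem_rows) hN (X := X) (v := [])
        (by simpa using hcur) (by simp [hs.sum_eq]) (by simp) (by simp [hs.scratch_eq])]
    simp [hs.rows'_eq, List.drop_of_length_le, hX.1, rows]
  rw [step]
  simp only [eval_block_cons, eval_block_nil, eval_discardTop]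
  rw [hmul, eval_move (by decide) (by simpa using hs.length_le), ha]
  simp only [eval, eval_block_cons, eval_block_nil]
  rw [eval_move (k := Tape.sum) (by decide) (by simpa [length_indicator] using by omega),
    eval_move (k := Tape.scratch) (by decide)
      (by simpa [length_indicator, hs.scratch_eq] using by omega)]
  congr 1
  · simp [isTrue]
  · funext k
    cases k <;> simp [hs.rows_eq, hs.rows'_eq, hs.sum_eq, hs.scratch_eq]

end Step

section CheckStates

variable {n N : ℕ} {A : NFA Unit (Fin N)} {s t u : Tapes}

theorem eval_pass [NeZero N] (hs : Ready A n s) {X : List Bool} {S : Set (Fin N)}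
    (hX : Represents X S) (hcur : s .cur = X.map some) :
    pass.eval n s = update s .cur ((indicator (A.stepSet S ())).map some) := by
  rw [pass, eval_step hs _ hX hcur, eval]

theorem iterate_eval_pass [NeZero N] (hs : Ready A n s) (j : ℕ) {X : List Bool} {S : Set (Fin N)}
    (hX : Represents X S) (hcur : s .cur = X.map some) :
    (pass.eval n)^[j + 1] s =
      update s .cur ((indicator (A.evalFrom S (List.replicate (j + 1) ()))).map some) := by
  induction j generalizing s X S with
  | zero => exact eval_pass hs hX hcur
  | succ j ih =>
    rw [Function.iterate_succ_apply, eval_pass hs hX hcur,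
      ih (hs.update (by decide) _) (represents_indicator (A.stepSet S ())) (by simp),
      Function.update_idem, List.replicate_succ (n := j + 1), NFA.evalFrom_cons]

/-- The stacks `t` arise from `s` by pushing symbols on `fault`, at least one if `c` fails, and none
otherwise. -/
def FaultsUnless (c : Prop) (s t : Tapes) : Prop :=
  ∃ f, t = update s .fault (f ++ s .fault) ∧ (f = [] ↔ c)

theorem FaultsUnless.trans {c d : Prop} (h : FaultsUnless c s t) (h' : FaultsUnless d t u) :
    FaultsUnless (c ∧ d) s u := by
  obtain ⟨f, rfl, hf⟩ := h
  obtain ⟨g, rfl, hg⟩ := h'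
  exact ⟨g ++ f, by simp, by simp [hf, hg, and_comm]⟩

theorem FaultsUnless.update {c : Prop} (h : FaultsUnless c s t) {k : Tape} (hk : k ≠ .fault)
    (x : List (Option Bool)) : FaultsUnless c (update s k x) (update t k x) := by
  obtain ⟨f, rfl, hf⟩ := h
  exact ⟨f, by simp [hk.symm, Function.update_comm hk], hf⟩

theorem foldl_compareSymbol {Y Z : List Bool} (hYZ : Y.length = Z.length)
    (hZ : s .prev = Z.map some) :
    FaultsUnless (Y = Z)
      (Function.update (Function.update s .prev []) .flag
        (List.replicate (Y.count true) none ++ s .flag))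
      ((Y.map some).foldl (fun t a => (compareSymbol a).eval n t) s) := by
  induction Y generalizing Z s with
  | nil =>
    obtain rfl : Z = [] := List.length_eq_zero_iff.1 hYZ.symm
    exact ⟨[], by funext k; cases k <;> simp [hZ], by simp⟩
  | cons y Y ih =>
    obtain ⟨z, Z, rfl⟩ := List.exists_cons_of_length_eq_add_one hYZ.symm
    have hfirst : FaultsUnless (y = z) (Function.update (Function.update s .prev (Z.map some))
        .flag (List.replicate ([y].count true) none ++ s .flag))
        ((compareSymbol (some y)).eval n s) := by
      refine ⟨if z = y then [] else [none], ?_, ?_⟩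
      · funext k
        cases k <;> cases y <;> cases z <;> simp [compareSymbol, eval, hZ]
      · cases y <;> cases z <;> simp
    obtain ⟨hprev, hflag⟩ : (compareSymbol (some y)).eval n s .prev = Z.map some ∧
        (compareSymbol (some y)).eval n s .flag =
          List.replicate ([y].count true) none ++ s .flag := by
      obtain ⟨f, hf, -⟩ := hfirst
      simp [hf]
    have hrest := ih (by simpa using hYZ) hprev
    rw [hflag] at hrest
    convert ((hfirst.update (k := .prev) (by decide) []).update (k := .flag) (by decide) _).trans
      hrest using 1
    · rw [List.cons_eq_cons]
    · funext k
      cases k <;> cases y <;> simp [List.replicate_succ']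
    · rfl

theorem eval_checkUnique {c : ℕ} (hflag : s .flag = List.replicate c none) (hc : c ≤ n) :
    FaultsUnless (c = 1) (Function.update s .flag []) (checkUnique.eval n s) := by
  cases c with
  | zero =>
    exact ⟨[none], by simp [checkUnique, eval, hflag], by simp⟩
  | succ c =>
    refine ⟨List.replicate c none, ?_, by simp [List.replicate_eq_nil_iff]⟩
    have hpop : checkUnique.eval n s =
        (move Tape.flag .fault).eval n (Function.update s .flag (List.replicate c none)) := by
      simp [checkUnique, eval, hflag, List.replicate_succ]
    rw [hpop, eval_move (by decide) (by simpa using by omega)]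
    simp

theorem eval_compareSets {Y Z : List Bool} (hYZ : Y.length = Z.length)
    (hY : s .cur = Y.map some) (hZ : s .prev = Z.map some) (hflag : s .flag = [])
    (hn : Y.length ≤ n) :
    FaultsUnless (Y = Z ∧ Y.count true = 1)
      (Function.update (Function.update s .cur []) .prev []) (compareSets.eval n s) := by
  have hcompare : FaultsUnless (Y = Z)
      (Function.update (Function.update (Function.update s .cur []) .prev []) .flag
        (List.replicate (Y.count true) none)) ((forEach .cur compareSymbol).eval n s) := by
    rw [eval_forEach (by decide) (by simpa [hY] using hn), hY]
    simpa [hflag] using foldl_compareSymbol (n := n) (s := Function.update s .cur []) hYZ (by simpa)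
  obtain ⟨f, hf, -⟩ := id hcompare
  have hunique := eval_checkUnique (n := n) (c := Y.count true)
    (s := (forEach .cur compareSymbol).eval n s) (by simp [hf]) (List.count_le_length.trans hn)
  convert (hcompare.update (k := .flag) (by decide) []).trans hunique using 1
  · funext k
    cases k <;> simp [hflag]
  · rfl

theorem eval_runFromUnit [NeZero N] (hs : Ready A n s) (p : Fin N)
    (hunit : s .unit = (unitVector p).map some) (hcur : s .cur = []) (hprev : s .prev = []) :
    runFromUnit.eval n s = Function.update (Function.update s
      .prev ((indicator (A.evalFrom {p} (List.replicate n ()))).map some))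
      .cur ((indicator (A.evalFrom {p} (List.replicate (n + 1) ()))).map some) := by
  have hN := hs.add_two_le
  obtain ⟨m, rfl⟩ : ∃ m, n = m + 1 := ⟨n - 1, by omega⟩
  simp only [runFromUnit, eval_block_cons, eval_block_nil]
  rw [eval_duplicate (by decide) (by decide) (by decide) hs.scratch_eq
      (by simpa [hunit] using by omega), eval,
    iterate_eval_pass (hs.update (by decide) _) m (represents_unitVector p)
      (by simp [hunit, hcur]),
    eval_duplicate (by decide) (by decide) (by decide) (by simp [hs.scratch_eq])
      (by simpa [length_indicator] using by omega),
    eval_pass (((hs.update (by decide) _).update (by decide) _).update (by decide) _)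
      (represents_indicator _) (by simp; rfl)]
  funext k
  cases k <;> simp [hprev, List.replicate_succ', NFA.evalFrom_append]

theorem eval_checkState [NeZero N] (hs : Ready A n s) (p : Fin N)
    (hunit : s .unit = (unitVector p).map some) (hcur : s .cur = []) (hprev : s .prev = [])
    (hflag : s .flag = []) :
    FaultsUnless (∃ q, ConvergesTo A n p q)
      (Function.update s .unit ((unitVector (p + 1)).map some)) (checkState.eval n s) := by
  have hN := hs.add_two_le
  have hcompare := eval_compareSets (n := n) (s := runFromUnit.eval n s)
    (Y := indicator (A.evalFrom {p} (List.replicate (n + 1) ())))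
    (Z := indicator (A.evalFrom {p} (List.replicate n ()))) (by simp only [length_indicator])
    (by simp [eval_runFromUnit hs p hunit hcur hprev])
    (by simp [eval_runFromUnit hs p hunit hcur hprev])
    (by simp [eval_runFromUnit hs p hunit hcur hprev, hflag])
    (by rw [length_indicator]; omega)
  obtain ⟨f, hf, -⟩ := id hcompare
  have hconverges : (∃ q, ConvergesTo A n p q) ↔
      A.evalFrom {p} (List.replicate (n + 1) ()) = A.evalFrom {p} (List.replicate n ()) ∧
        ∃ q, A.evalFrom {p} (List.replicate (n + 1) ()) = {q} :=
    ⟨fun ⟨q, hn, hq⟩ => ⟨hq.trans hn.symm, q, hq⟩, fun ⟨h, q, hq⟩ => ⟨q, h.symm.trans hq, hq⟩⟩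
  rw [hconverges, ← count_indicator_eq_one, ← indicator_injective.eq_iff]
  convert hcompare.update (k := .unit) (by decide) ((unitVector (p + 1)).map some) using 1
  · funext k
    cases k <;> simp [eval_runFromUnit hs p hunit hcur hprev, hcur, hprev]
  · have hunit' : compareSets.eval n (runFromUnit.eval n s) .unit = (unitVector p).map some := by
      rw [hf]
      simp [eval_runFromUnit hs p hunit hcur hprev, hunit]
    simp [checkState, eval, unitVector, hunit']

theorem eval_checkStates [NeZero N] (hs : Ready A n s) (hstates : (s .states).length = N)
    (hunit : s .unit = (unitVector 0).map some) (hcur : s .cur = []) (hprev : s .prev = [])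
    (hflag : s .flag = []) :
    FaultsUnless (∀ p, ∃ q, ConvergesTo A n p q)
      (Function.update (Function.update s .states []) .unit ((unitVector N).map some))
      (checkStates.eval n s) := by
  have hN := hs.add_two_le
  have hfold (x : List (Option Bool)) (s : Tapes) (p : ℕ) (hp : p + x.length = N)
      (hs : Ready A n s) (hunit : s .unit = (unitVector p).map some) (hcur : s .cur = [])
      (hprev : s .prev = []) (hflag : s .flag = []) :
      FaultsUnless (∀ i : Fin N, p ≤ i → ∃ q, ConvergesTo A n i q)
        (Function.update s .unit ((unitVector N).map some))
        (x.foldl (fun t _ => checkState.eval n t) s) := by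
    induction x generalizing s p with
    | nil =>
      obtain rfl : p = N := hp
      exact ⟨[], by simp [← hunit], by simp⟩
    | cons a x ih =>
      rw [List.length_cons] at hp
      have hfirst := eval_checkState hs ⟨p, by omega⟩ hunit hcur hprev hflag
      obtain ⟨f, hf, -⟩ := id hfirst
      have hrest := ih (checkState.eval n s) (p + 1) (by omega)
        (by rw [hf]; exact (hs.update (by decide) _).update (by decide) _)
        (by simp [hf]) (by simp [hf, hcur]) (by simp [hf, hprev]) (by simp [hf, hflag])
      have hforall : (∀ i : Fin N, p ≤ i → ∃ q, ConvergesTo A n i q) ↔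
          (∃ q, ConvergesTo A n ⟨p, by omega⟩ q) ∧
            ∀ i : Fin N, p + 1 ≤ i → ∃ q, ConvergesTo A n i q := by
        refine ⟨fun h => ⟨h _ le_rfl, fun i hi => h i (by omega)⟩, fun h i hi => ?_⟩
        rcases hi.eq_or_lt with rfl | hi
        · exact h.1
        · exact h.2 i hi
      rw [hforall]
      simpa using (hfirst.update (k := Tape.unit) (by decide) _).trans hrest
  rw [checkStates, eval_forEach (by decide) (by omega)]
  simpa using hfold (s .states) (Function.update s .states []) 0 (by simpa using hstates)
    (hs.update (by decide) _) (by simpa) (by simpa) (by simpa) (by simpa)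

end CheckStates

section Parse

variable {n N : ℕ} {s : Tapes}

/-- The contents of the stacks after the input has been read. -/
noncomputable def parsedTapes (A : NFA Unit (Fin N)) (key : List Bool) : Tapes
  | .rows => encodeRows (rows A)
  | .key => key.map some
  | .initial => ((indicator A.start).map some).reverse
  | .states => List.replicate N none
  | .unit => (unitVector 0).map some
  | _ => []

theorem foldl_parseSymbol_key (key : List Bool) (hs : s .rows' = []) :
    (key.map some).foldl (fun t a => (parseSymbol a).eval n t) s =
      update s .scratch ((key.map some).reverse ++ s .scratch) := by
  induction key generalizing s with
  | nil => simp
  | cons b key ih =>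
    have hfirst : (parseSymbol (some b)).eval n s = update s .scratch (some b :: s .scratch) := by
      simp [parseSymbol, hs, eval]
    rw [List.map_cons, List.foldl_cons, hfirst, ih (by simpa)]
    simp

theorem foldl_parseSymbol_row (l : List Bool) {b : Bool} (hs : (s .rows').head? = some (some b)) :
    (l.map some ++ [none]).foldl (fun t a => (parseSymbol a).eval n t) s =
      update s .rows' ((l.map some ++ [none]).reverse ++ s .rows') := by
  induction l generalizing s b with
  | nil => simp [parseSymbol, hs, eval]
  | cons c l ih =>
    have hfirst : (parseSymbol (some c)).eval n s = update s .rows' (some c :: s .rows') := by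
      simp [parseSymbol, hs, eval]
    rw [List.map_cons, List.cons_append, List.foldl_cons, hfirst, ih (b := c) (by simp)]
    simp

theorem foldl_parseSymbol_encodeRows {rows : List (List Bool)} (hrows : ∀ l ∈ rows, l ≠ [])
    (hs : (s .rows').head? = some none) :
    (encodeRows rows).foldl (fun t a => (parseSymbol a).eval n t) s =
      update (update (update s .rows' ((encodeRows rows).reverse ++ s .rows'))
        .initial (((rows.map (·.headD false)).map some).reverse ++ s .initial))
        .states (List.replicate rows.length none ++ s .states) := by
  induction rows generalizing s with
  | nil => simp [encodeRows]
  | cons l rows ih =>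
    obtain ⟨b, l, rfl⟩ := List.exists_cons_of_ne_nil (hrows l List.mem_cons_self)
    have hfirst : (parseSymbol (some b)).eval n s =
        update (update (update s .initial (some b :: s .initial)) .states (none :: s .states))
          .rows' (some b :: s .rows') := by
      simp [parseSymbol, hs, eval]
    rw [encodeRows, List.flatMap_cons, List.map_cons, List.cons_append, List.cons_append,
      List.foldl_cons, hfirst, List.foldl_append, foldl_parseSymbol_row l (b := b) (by simp),
      ← encodeRows, ih (fun l hl => hrows l (List.mem_cons_of_mem _ hl)) (by simp)]
    funext k
    cases k <;> simp [List.replicate_succ']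

theorem eval_parse (A : NFA Unit (Fin N)) (key : List Bool)
    (hn : (key.map some ++ none :: encodeRows (rows A)).length ≤ n) :
    parse.eval n
      (update (fun _ => []) .scratch (key.map some ++ none :: encodeRows (rows A)).reverse) =
      parsedTapes A key := by
  have hrows : ∀ l ∈ rows A, l ≠ [] := fun l hl =>
    List.ne_nil_of_length_pos (by simp [length_of_mem_rows hl])
  have hfold (s : Tapes) (hs : s .rows' = []) :
      (key.map some ++ none :: encodeRows (rows A)).foldl (fun t a => (parseSymbol a).eval n t) s =
      update (update (update (update s .scratch ((key.map some).reverse ++ s .scratch))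
        .rows' (none :: encodeRows (rows A)).reverse)
        .initial (((indicator A.start).map some).reverse ++ s .initial))
        .states (List.replicate N none ++ s .states) := by
    rw [List.foldl_append, foldl_parseSymbol_key key hs, List.foldl_cons,
      foldl_parseSymbol_encodeRows hrows (by simp [parseSymbol, hs, eval]),
      map_headD_rows, length_rows]
    funext k
    cases k <;> simp [parseSymbol, hs, eval]
  rw [List.length_append, List.length_cons, List.length_map] at hn
  rw [parse, eval_block_cons, eval_move (by decide) (by simpa using by omega), eval_block_cons,
    eval_forEach (by decide) (by simpa using by omega)]
  simp only [Function.update_self, List.reverse_reverse, List.append_nil, ne_eq, reduceCtorEq,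
    not_false_eq_true, Function.update_of_ne]
  rw [hfold _ (by simp), eval_block_cons, eval_move (by decide) (by simpa using by omega),
    eval_block_cons, eval_move (by decide) (by simpa using by omega)]
  funext k
  cases k <;> simp [parsedTapes, eval, unitVector]

end Parse

section Advance

variable {n N : ℕ} {A : NFA Unit (Fin N)} {s : Tapes}

/-- The number with the given binary digits, the least significant one first. -/
def value (l : List Bool) : ℕ :=
  Nat.ofDigits 2 (l.map Bool.toNat)

/-- Subtracts `1` from a positive number in binary. -/
def pred : List Bool → List Bool
  | [] => []
  | false :: l => true :: pred l
  | true :: l => false :: l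

@[simp]
theorem value_nil : value [] = 0 :=
  rfl

@[simp]
theorem value_cons (b : Bool) (l : List Bool) : value (b :: l) = b.toNat + 2 * value l :=
  Nat.ofDigits_cons ..

@[simp]
theorem length_pred (l : List Bool) : (pred l).length = l.length := by
  induction l with
  | nil => rfl
  | cons b l ih => cases b <;> simp [pred, ih]

theorem value_pred {l : List Bool} (hl : value l ≠ 0) : value (pred l) = value l - 1 := by
  induction l with
  | nil => rfl
  | cons b l ih =>
    cases b with
    | false =>
      rw [value_cons] at hl ⊢
      simp only [pred, value_cons, Bool.toNat_false, Bool.toNat_true] at hl ⊢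
      rw [ih (by omega)]
      omega
    | true => simp [pred]

theorem value_encodeNat (k : ℕ) : value (Computability.encodeNat k) = k := by
  have hpos (m : PosNum) : value (Computability.encodePosNum m) = m := by
    induction m with
    | one => rfl
    | bit0 m ih => simp [Computability.encodePosNum, ih, two_mul]
    | bit1 m ih => simp [Computability.encodePosNum, ih, two_mul, add_comm]
  have hnum : (m : Num) → value (Computability.encodeNum m) = m
    | Num.zero => rfl
    | Num.pos m => hpos m
  exact (hnum k).trans (Num.to_of_nat k)

theorem foldl_decrementBit_of_flag_eq_nil (l : List Bool) (hflag : s .flag = []) :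
    (l.map some).foldl (fun t a => (decrementBit a).eval n t) s =
      update s .scratch ((l.map some).reverse ++ s .scratch) := by
  induction l generalizing s with
  | nil => simp
  | cons b l ih =>
    have hfirst : (decrementBit (some b)).eval n s = update s .scratch (some b :: s .scratch) := by
      funext k
      cases k <;> simp [decrementBit, eval, hflag]
    rw [List.map_cons, List.foldl_cons, hfirst, ih (by simpa)]
    simp

theorem foldl_decrementBit (l : List Bool) (hflag : s .flag = [none]) :
    (l.map some).foldl (fun t a => (decrementBit a).eval n t) s =
      update (update s .scratch (((pred l).map some).reverse ++ s .scratch))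
        .flag (if value l = 0 then [none] else []) := by
  induction l generalizing s with
  | nil => simp [pred, ← hflag]
  | cons b l ih =>
    rw [List.map_cons, List.foldl_cons]
    cases b with
    | false =>
      have hfirst : (decrementBit (some false)).eval n s =
          update s .scratch (some true :: s .scratch) := by
        funext k
        cases k <;> simp [decrementBit, eval, hflag]
      rw [hfirst, ih (by simpa)]
      simp [pred]
    | true =>
      have hfirst : (decrementBit (some true)).eval n s =
          update (update s .scratch (some false :: s .scratch)) .flag [] := by
        funext k
        cases k <;> simp [decrementBit, eval, hflag]
      rw [hfirst, foldl_decrementBit_of_flag_eq_nil l (by simp)]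
      funext k
      cases k <;> simp [pred]

theorem eval_advanceStep [NeZero N] (hs : Ready A n s) (hflag : s .flag = []) {l : List Bool}
    (hkey : s .key = l.map some) (hl : l.length ≤ n) {S : Set (Fin N)}
    (hcur : s .cur = (indicator S).map some) :
    advanceStep.eval n s = if value l = 0 then update s .key [] else
      update (update s .key ((pred l).map some)) .cur
        ((indicator (A.stepSet S ())).map some) := by
  have hdecrement : (forEach .key decrementBit).eval n ((push .flag none).eval n s) =
      update (update (update s .key []) .scratch ((pred l).map some).reverse)
        .flag (if value l = 0 then [none] else []) := by
    rw [eval_forEach (by decide) (by simpa [eval, hkey] using hl), eval,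
      Function.update_of_ne (by decide), hkey, foldl_decrementBit _ (by simp [hflag])]
    funext k
    cases k <;> simp [hs.scratch_eq]
  simp only [advanceStep, eval_block_cons, eval_block_nil]
  rw [hdecrement]
  split_ifs with h
  · simp only [eval, Function.update_self, List.head?_cons, Option.elim_some, List.tail_cons]
    rw [eval_forEach (by decide) (by simpa using hl)]
    have hskip (x : List (Option Bool)) (t : Tapes) :
        x.foldl (fun t _ => (skip : Program).eval n t) t = t := by
      induction x <;> simp_all [eval]
    rw [hskip]
    funext k
    cases k <;> simp [hs.scratch_eq, hflag]
  · simp only [eval, Function.update_self, List.head?_nil, Option.elim_none, List.tail_nil,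
      eval_block_cons, eval_block_nil]
    rw [eval_move (by decide) (by simpa using hl), eval_pass (A := A) (S := S) (X := indicator S)]
    · funext k
      cases k <;> simp [hflag, hs.scratch_eq]
    · exact ⟨hs.length_le, by simp [hs.rows_eq], by simp [hs.rows'_eq], by simp [hs.sum_eq],
        by simp⟩
    · exact represents_indicator S
    · simp [hcur]

theorem iterate_eval_advanceStep [NeZero N] (hs : Ready A n s) (hflag : s .flag = [])
    {l : List Bool} (hkey : s .key = l.map some) (hl : l.length ≤ n) {S : Set (Fin N)}
    (hcur : s .cur = (indicator S).map some) (j : ℕ) :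
    ∃ y, (advanceStep.eval n)^[j] s = update (update s .key y) .cur
      ((indicator (A.evalFrom S (List.replicate (min (value l) j) ()))).map some) := by
  induction j generalizing s l S with
  | zero => exact ⟨s .key, by simp [← hcur]⟩
  | succ j ih =>
    rw [Function.iterate_succ_apply, eval_advanceStep hs hflag hkey hl hcur]
    split_ifs with h
    · obtain ⟨y, hy⟩ := ih (hs.update (k := .key) (by decide) []) (by simpa) (l := []) (by simp)
        (by simp) (by simpa)
      exact ⟨y, by simpa [h] using hy⟩
    · obtain ⟨y, hy⟩ := ih ((hs.update (k := .key) (by decide) ((pred l).map some)).update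
        (k := .cur) (by decide) ((indicator (A.stepSet S ())).map some)) (by simpa) (l := pred l)
        (by simp) (by simpa) (S := A.stepSet S ()) (by simp)
      have hmin : min (value l) (j + 1) = min (value (pred l)) j + 1 := by
        rw [value_pred h]
        omega
      refine ⟨y, ?_⟩
      rw [hy, hmin, List.replicate_succ, NFA.evalFrom_cons]
      funext k
      cases k <;> simp

end Advance

section CompareWords

variable {n N : ℕ} {A : NFA Unit (Fin N)} {s : Tapes}

open Classical in
theorem iterate_eval_step [NeZero N] (hs : Ready A n s) {S : Set (Fin N)}
    (hcur : s .cur = (indicator S).map some) (b : Bool) (j : ℕ) :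
    FaultsUnless (∀ i < j, decide (∃ q ∈ A.accept, q ∈ A.evalFrom S (List.replicate i ())) = b)
      (update s .cur ((indicator (A.evalFrom S (List.replicate j ()))).map some))
      (((step fun c => if c = b then skip else push .fault none).eval n)^[j] s) := by
  induction j with
  | zero => exact ⟨[], by simp [← hcur], by simp⟩
  | succ j ih =>
    set t := ((step fun c => if c = b then skip else push .fault none).eval n)^[j] s
    set c := decide (∃ q ∈ A.accept, q ∈ A.evalFrom S (List.replicate j ())) with hc
    have ⟨f, hf, _⟩ := ih
    have hready : Ready A n t := by
      rw [hf]
      exact (hs.update (by decide) _).update (by decide) _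
    have hstep := eval_step hready (fun c => if c = b then skip else push .fault none)
      (represents_indicator (A.evalFrom S (List.replicate j ()))) (by rw [hf]; simp)
    have hlast : FaultsUnless (c = b)
        (update t .cur ((indicator (A.evalFrom S (List.replicate (j + 1) ()))).map some))
        ((step fun c => if c = b then skip else push .fault none).eval n t) := by
      rw [hstep, ← hc, List.replicate_succ', NFA.evalFrom_append, NFA.evalFrom_cons,
        NFA.evalFrom_nil]
      split_ifs with h
      · exact ⟨[], by simp [eval], by simp [h]⟩
      · exact ⟨[none], by simp [eval], by simp [h]⟩
    simp only [Nat.forall_lt_succ_right]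
    rw [Function.iterate_succ_apply']
    simpa using (ih.update (k := Tape.cur) (by decide) _).trans hlast

open Classical in
theorem eval_compareWords [NeZero N] (hs : Ready A n s) (m : ℕ)
    (hcur : s .cur = (indicator (A.evalFrom A.start (List.replicate m ()))).map some) :
    ∃ x, FaultsUnless (∀ i < n, (List.replicate (m + (i + 1)) () ∈ A.accepts ↔
        List.replicate m () ∈ A.accepts)) (update s .cur x) (compareWords.eval n s) := by
  rw [compareWords, eval_step hs _ (represents_indicator _) hcur, eval]
  have hloop := iterate_eval_step (n := n) (hs.update (k := .cur) (by decide)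
    ((indicator (A.stepSet (A.evalFrom A.start (List.replicate m ())) ())).map some))
    (S := A.stepSet (A.evalFrom A.start (List.replicate m ())) ()) (by simp)
    (decide (∃ q ∈ A.accept, q ∈ A.evalFrom A.start (List.replicate m ()))) n
  have haccepts (i : ℕ) : (∃ q ∈ A.accept, q ∈ A.evalFrom
      (A.stepSet (A.evalFrom A.start (List.replicate m ())) ()) (List.replicate i ())) ↔
      List.replicate (m + (i + 1)) () ∈ A.accepts := by
    rw [NFA.mem_accepts, List.replicate_add, NFA.evalFrom_append, List.replicate_succ,
      NFA.evalFrom_cons]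
  have hiff : (∀ i < n, decide (∃ q ∈ A.accept, q ∈ A.evalFrom
      (A.stepSet (A.evalFrom A.start (List.replicate m ())) ()) (List.replicate i ())) =
        decide (∃ q ∈ A.accept, q ∈ A.evalFrom A.start (List.replicate m ()))) ↔
      ∀ i < n, (List.replicate (m + (i + 1)) () ∈ A.accepts ↔ List.replicate m () ∈ A.accepts) :=
    forall₂_congr fun i _ => by rw [decide_eq_decide, haccepts, ← NFA.mem_accepts]
  rw [hiff, Function.update_idem] at hloop
  exact ⟨_, hloop⟩

theorem eval_checkWords [NeZero N] (hs : Ready A n s) (hflag : s .flag = []) {key : List Bool}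
    (hkey : s .key = key.map some) (hn : key.length ≤ n)
    (hinitial : s .initial = ((indicator A.start).map some).reverse) (hcur : s .cur = []) :
    ∃ t, t .fault = s .fault ∧
      FaultsUnless (∀ i < n, (List.replicate (min (value key) n + (i + 1)) () ∈ A.accepts ↔
        List.replicate (min (value key) n) () ∈ A.accepts)) t (checkWords.eval n s) := by
  have hN := hs.add_two_le
  have hmove : (move Tape.initial .cur).eval n s =
      update (update s .initial []) .cur ((indicator A.start).map some) := by
    rw [eval_move (by decide) (by simpa [hinitial, length_indicator] using by omega)]
    simp [hinitial, hcur]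
  have hready := (hs.update (k := .initial) (by decide) []).update (k := .cur) (by decide)
    ((indicator A.start).map some)
  obtain ⟨y, hy⟩ := iterate_eval_advanceStep hready (by simpa) (l := key) (by simpa) hn
    (S := A.start) (by simp) n
  obtain ⟨x, hx⟩ := eval_compareWords (n := n) ((hready.update (k := .key) (by decide) y).update
    (k := .cur) (by decide) ((indicator (A.evalFrom A.start
      (List.replicate (min (value key) n) ()))).map some)) (min (value key) n) (by simp)
  refine ⟨_, ?_, by
    simpa only [checkWords, eval_block_cons, eval_block_nil, eval, hmove, hy] using hx⟩
  simp

end CompareWords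

theorem eval_decisionProgram {n N : ℕ} [NeZero N] (A : NFA Unit (Fin N)) (key : List Bool)
    (hn : (key.map some ++ none :: encodeRows (rows A)).length ≤ n) :
    decisionProgram.eval n (update (fun _ => []) .scratch
        (key.map some ++ none :: encodeRows (rows A)).reverse) .fault = [] ↔
      (∀ p, ∃ q, ConvergesTo A n p q) ∧
        ∀ i < n, (List.replicate (min (value key) n + (i + 1)) () ∈ A.accepts ↔
          List.replicate (min (value key) n) () ∈ A.accepts) := by
  have hkey : key.length + (encodeRows (rows A)).length ≤ n := by
    rw [List.length_append, List.length_cons, List.length_map] at hn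
    omega
  have hready : Ready A n (parsedTapes A key) := ⟨by omega, rfl, rfl, rfl, rfl⟩
  obtain ⟨f, hf, hfc⟩ := eval_checkStates hready List.length_replicate rfl rfl rfl rfl
  obtain ⟨t, ht, g, hg, hgc⟩ := eval_checkWords (n := n)
    (s := checkStates.eval n (parsedTapes A key)) (key := key) (by
      rw [hf]
      exact ((hready.update (by decide) _).update (by decide) _).update (by decide) _)
    (by rw [hf]; rfl) (by rw [hf]; rfl) (by omega) (by rw [hf]; rfl) (by rw [hf]; rfl)
  simp only [decisionProgram, eval_block_cons, eval_block_nil]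
  rw [eval_parse A key hn, hg, ← hfc, ← hgc]
  simp [ht, hf, parsedTapes, and_comm]

theorem decidableInPolyTime_isKPiecewiseTestable : DecidableInPolyTime encodeInstance
    {x : UnaryNFA × ℕ | x.1.2.IsPtNFA ∧ IsKPiecewiseTestable x.2 x.1.2.accepts} := by
  refine LoopProgram.decidableInPolyTime decisionProgram .scratch .fault ?_
  rintro ⟨⟨N, A⟩, k⟩
  set n := (encodeInstance (⟨N, A⟩, k)).length with hn
  rw [encodeInstance_eq] at hn ⊢
  have hcard : Fintype.card (Fin (N + 1)) ≤ n := by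
    rw [hn, List.length_append, List.length_cons, length_encodeRows_rows, Fintype.card_fin]
    nlinarith
  rw [eval_decisionProgram A _ hn.ge, value_encodeNat,
    ← isPtNFA_iff_forall_exists_convergesTo hcard]
  exact and_congr_right fun hA => (isKPiecewiseTestable_iff_of_card_le hA k hcard).symm

end UnaryNFA

theorem theorem6p10_general.{u} :
    DecidableInPolyTime encodeInstance
      {x : UnaryNFA × ℕ | x.1.2.IsPtNFA ∧ IsKPiecewiseTestable x.2 x.1.2.accepts} ∧
    ∀ {σ : Type u} (A : NFA Unit σ) (k : ℕ), A.IsPtNFA → BddAbove (UnaryNFA.simplePathLengths A) →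
      (IsKPiecewiseTestable k A.accepts ↔
        ∀ j, k < j → j ≤ A.depth →
          (List.replicate j () ∈ A.accepts ↔ List.replicate k () ∈ A.accepts)) :=
  ⟨UnaryNFA.decidableInPolyTime_isKPiecewiseTestable, fun _ k h hA =>
    UnaryNFA.isKPiecewiseTestable_iff_depth h hA k⟩

/-- The pairs of a ptNFA `A` over a unary alphabet and a number `k`, in binary, for which `L(A)`
is `k`-piecewise testable are decidable in polynomial time. Moreover, `L(A)` is `k`-piecewise
testable if and only if the acceptance of `a^j` agrees with that of `a^k` whenever
`k < j ≤ depth(A)`. -/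
theorem theorem6p10 :
    DecidableInPolyTime encodeInstance
      {x : UnaryNFA × ℕ | x.1.2.IsPtNFA ∧ IsKPiecewiseTestable x.2 x.1.2.accepts} ∧
    ∀ (A : UnaryNFA) (k : ℕ), A.2.IsPtNFA →
      (IsKPiecewiseTestable k A.2.accepts ↔
        ∀ j, k < j → j ≤ A.2.depth →
          (List.replicate j () ∈ A.2.accepts ↔ List.replicate k () ∈ A.2.accepts)) :=
  ⟨theorem6p10_general.{0}.1, fun A k hA =>
    theorem6p10_general.2 A.2 k hA UnaryNFA.bddAbove_simplePathLengths⟩
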